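/- Let $\beta>0$, $\lambda>0$, $\nu\in(0,1)$. Consider the following generalized Yule model of a growing network. One webpage is present at time $0$, and the number of webpages is a Yule process of rate $\beta$: with $k$ webpages present, the next one is created after an exponential time of rate $\beta k$, these times being independent. The number of in-links of each webpage, as a function of its age, is an independent copy of the fractional Yule process $\mathfrak N^\nu_{\rm lin}$, and these copies are independent of the creation of the webpages. Here $\mathfrak N^\nu_{\rm lin}$ is the fractional birth process with linear rates $\lambda_r=\lambda r$: a counting process with right-continuous nondecreasing paths increasing by unit jumps, started from $1$, whose state probabilities $p_n(t)=\mathbb P(\mathfrak N^\nu_{\rm lin}(t)=n)$ are locally absolutely continuous on $[0,\infty)$ and satisfy, with the convention $p_0=0$, $$\frac{1}{\Gamma(1-\nu)}\int_0^t \frac{p_n'(s)}{(t-s)^{\nu}}\,ds=-\lambda n\,p_n(t)+\lambda(n-1)\,p_{n-1}(t),\qquad p_n(0)=\delta_{n,1},\qquad n\ge 1,\ t>0 .$$ For $t>0$ choose a webpage uniformly at random among those present at time $t$ and let ${}_tN$ be its number of in-links at time $t$. Let $q_t(n)$ be the conditional probability of ${}_tN=n$ given that the chosen webpage was created after time $0$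 (i.e. it is not the initial webpage). Write $\gamma(a,x)=\int_0^x u^{a-1}e^{-u}du$ and $\Gamma(a,x)=\int_x^\infty u^{a-1}e^{-u}du$. (i) For all $t>0$ and $n\ge1$, $$q_t(n)=\frac{\beta}{1-e^{-\beta t}}\left[\frac{\beta^{\nu-1}}{\lambda}\,\frac{\Gamma\left(\frac{\beta^\nu}{\lambda}+1\right)\Gamma(n)}{\Gamma\left(\frac{\beta^\nu}{\lambda}+n+1\right)}-\int_t^\infty e^{-\beta y}\,\mathbb P(\mathfrak N^\nu_{\rm lin}(y)=n)\,dy\right],$$ the integral being convergent, and $$q_t(n)=\frac{1}{1-e^{-\beta t}}\sum_{j=1}^n\binom{n-1}{j-1}(-1)^{j-1}\sum_{r=0}^\infty\frac{\gamma(\nu r+1,\beta t)}{\Gamma(\nu r+1)}\left(-\frac{\lambda j}{\beta^\nu}\right)^r,$$ where all the series converge. (ii) For $t>0$ and an integer $j\ge1$, the series $\sum_{r\ge0}\frac{\Gamma(\nu r+1,\beta t)}{\Gamma(\nu r+1)}\left(-\frac{\lambda j}{\beta^\nu}\right)^r$ converges absolutely if and only if $\lambda j<\beta^\nu$. If $\lambda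 n<\beta^\nu$, then $$q_t(n)=\frac{1}{1-e^{-\beta t}}\left[\frac{\beta^{\nu}}{\lambda}\,\frac{\Gamma\left(\frac{\beta^\nu}{\lambda}+1\right)\Gamma(n)}{\Gamma\left(\frac{\beta^\nu}{\lambda}+n+1\right)}-\sum_{j=1}^n\binom{n-1}{j-1}(-1)^{j-1}\sum_{r=0}^\infty\frac{\Gamma(\nu r+1,\beta t)}{\Gamma(\nu r+1)}\left(-\frac{\lambda j}{\beta^\nu}\right)^r\right].$$ (iii) For every $n\ge1$, $$\lim_{t\to\infty}q_t(n)=\lim_{t\to\infty}\mathbb P({}_tN=n)=\frac{\beta^\nu}{\lambda}\,\frac{\Gamma\left(\frac{\beta^\nu}{\lambda}+1\right)\Gamma(n)}{\Gamma\left(\frac{\beta^\nu}{\lambda}+n+1\right)},$$ and these limits sum to $1$ over $n\ge1$: they form the classical Yule--Simon distribution of parameter $\rho^{-1}=\beta^\nu/\lambda$. -/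

import Mathlib

open MeasureTheory ProbabilityTheory Filter Topology
open scoped NNReal ENNReal

namespace FractionalYule

/-- The lower incomplete Gamma function `γ(a, x)`. -/
noncomputable def lowerGamma (a x : ℝ) : ℝ :=
  ∫ u in (0 : ℝ)..x, u ^ (a - 1) * Real.exp (-u)

/-- The upper incomplete Gamma function `Γ(a, x)`. -/
noncomputable def upperGamma (a x : ℝ) : ℝ :=
  ∫ u in Set.Ioi x, u ^ (a - 1) * Real.exp (-u)

/-- The probability that the classical Yule–Simon distribution of parameter `a` gives to `n ≥ 1`. -/
noncomputable def yuleSimon (a : ℝ) (n : ℕ) : ℝ :=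
  a * (Real.Gamma (a + 1) * Real.Gamma n / Real.Gamma (a + n + 1))

/-- The Caputo derivative of order `ν ∈ (0, 1)`, with base point `0`, of `f` at `t > 0`. -/
noncomputable def caputoDeriv (ν : ℝ) (f : ℝ → ℝ) (t : ℝ) : ℝ :=
  (Real.Gamma (1 - ν))⁻¹ * ∫ s in (0 : ℝ)..t, deriv f s / (t - s) ^ ν

section Model

variable {Ω : Type*} [MeasurableSpace Ω]

/-- The state probability `P(X(s) = n)`, as a function of the real time `s ≥ 0`. -/
noncomputable def stateProb (P : Measure Ω) (X : ℝ≥0 → Ω → ℕ) (n : ℕ) (s : ℝ) : ℝ :=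
  P.real {ω | X s.toNNReal ω = n}

/-- `X` is a fractional nonlinear birth process of order `ν` with rates `rate 1, rate 2, …`,
started from one individual: a counting process with right-continuous nondecreasing paths that
increase by unit jumps, whose state probabilities `pₙ` are (locally) absolutely continuous and
satisfy `d^ν pₙ / dt^ν = - rate n * pₙ + rate (n-1) * pₙ₋₁`, `n ≥ 1`, with the Caputo derivative.
The initial conditions `pₙ(0) = δ_{n,1}` and the convention `p₀ = 0` are contained in `initial`
and `monotone`. -/
structure IsFractionalBirthProcess (P : Measure Ω) (ν : ℝ) (rate : ℕ → ℝ)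
    (X : ℝ≥0 → Ω → ℕ) : Prop where
  measurable : ∀ s, Measurable (X s)
  initial : ∀ ω, X 0 ω = 1
  monotone : ∀ ω, Monotone fun s => X s ω
  right_continuous : ∀ ω s, ContinuousWithinAt (fun u => X u ω) (Set.Ici s) s
  unit_jumps : ∀ ω s (m : ℕ), 1 ≤ m → m ≤ X s ω → ∃ u ≤ s, X u ω = m
  absolutelyContinuous : ∀ n : ℕ, 1 ≤ n → ∀ b : ℝ, 0 < b →
    AbsolutelyContinuousOnInterval (stateProb P X n) 0 b
  governing : ∀ n : ℕ, 1 ≤ n → ∀ t : ℝ, 0 < t →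
    caputoDeriv ν (stateProb P X n) t
      = -rate n * stateProb P X n t + rate (n - 1) * stateProb P X (n - 1) t

/-- The creation time of webpage number `k`: webpage `0` is present at time `0`, and `S i` is the
time elapsed between the creations of the webpages `i` and `i + 1`. -/
def creationTime (S : ℕ → Ω → ℝ) (k : ℕ) (ω : Ω) : ℝ :=
  ∑ i ∈ Finset.range k, S i ω

/-- The number of webpages present at time `t`. -/
noncomputable def numPages (S : ℕ → Ω → ℝ) (t : ℝ) (ω : Ω) : ℕ :=
  {k : ℕ | creationTime S k ω ≤ t}.ncard

/-- The generalized Yule model. The number of webpages is a Yule process of rate `β` with one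
initial webpage: the holding times are independent, and that with `k + 1` webpages present is
exponential of rate `β * (k + 1)`. Webpage `k` has `X k s` in-links when its age is `s`; the
processes `X k` are independent copies of a fractional nonlinear birth process, and they are
independent of the creation of the webpages. -/
structure IsGeneralizedYuleModel (P : Measure Ω) (β ν : ℝ) (rate : ℕ → ℝ)
    (S : ℕ → Ω → ℝ) (X : ℕ → ℝ≥0 → Ω → ℕ) : Prop where
  measurable_holding : ∀ k, Measurable (S k)
  law_holding : ∀ k : ℕ, P.map (S k) = expMeasure (β * (k + 1))
  indep_holding : iIndepFun S P
  birth : ∀ k, IsFractionalBirthProcess P ν rate (X k)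
  identDistrib : ∀ k, IdentDistrib (fun ω s => X k s ω) (fun ω s => X 0 s ω) P P
  indep_inlinks : iIndepFun (fun k ω s => X k s ω) P
  indep_holding_inlinks : IndepFun (fun ω k => S k ω) (fun ω k s => X k s ω) P

/-- The information on the whole network: all the holding times and all the in-link processes. -/
@[reducible] def networkInfo (S : ℕ → Ω → ℝ) (X : ℕ → ℝ≥0 → Ω → ℕ) : MeasurableSpace Ω :=
  MeasurableSpace.comap (fun ω => ((fun k => S k ω), (fun k s => X k s ω)))
    (inferInstance : MeasurableSpace ((ℕ → ℝ) × (ℕ → ℝ≥0 → ℕ)))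

/-- `J` is the label of a webpage chosen uniformly at random among those present at time `t`:
conditionally on the whole network, `J = k` with probability `1 / numPages S t` for each of the
webpages `k` that are present at time `t`, and with probability `0` for the other ones. -/
structure IsUniformChoice (P : Measure Ω) (S : ℕ → Ω → ℝ) (X : ℕ → ℝ≥0 → Ω → ℕ) (t : ℝ)
    (J : Ω → ℕ) : Prop where
  measurable : Measurable J
  uniform : ∀ (k : ℕ) (A : Set Ω), MeasurableSet[networkInfo S X] A →
    P ({ω | J ω = k} ∩ A)
      = ∫⁻ ω in {ω | creationTime S k ω ≤ t} ∩ A, (numPages S t ω : ℝ≥0∞)⁻¹ ∂P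

/-- The number of in-links, at time `t`, of the webpage with the random label `J`. -/
noncomputable def chosenSize (S : ℕ → Ω → ℝ) (X : ℕ → ℝ≥0 → Ω → ℕ) (t : ℝ) (J : Ω → ℕ)
    (ω : Ω) : ℕ :=
  X (J ω) (t - creationTime S (J ω) ω).toNNReal ω

/-- The probability that the chosen webpage has `n` in-links at time `t`, given that it is one of
the webpages created after time `0`, i.e. one that has a random creation time. -/
noncomputable def condSizeProb (P : Measure Ω) (S : ℕ → Ω → ℝ) (X : ℕ → ℝ≥0 → Ω → ℕ) (t : ℝ)
    (J : Ω → ℕ) (n : ℕ) : ℝ :=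
  (ProbabilityTheory.cond P {ω | J ω ≠ 0}).real {ω | chosenSize S X t J ω = n}

end Model

/-- The `r`-th term of the series `∑ γ(νr+1, βt) / Γ(νr+1) * (-(λ j) / β^ν)^r`. -/
noncomputable def lowerTerm (β ν lam t : ℝ) (j r : ℕ) : ℝ :=
  lowerGamma (ν * r + 1) (β * t) / Real.Gamma (ν * r + 1) * (-(lam * j) / β ^ ν) ^ r

/-- The `r`-th term of the series `∑ Γ(νr+1, βt) / Γ(νr+1) * (-(λ j) / β^ν)^r`. -/
noncomputable def upperTerm (β ν lam t : ℝ) (j r : ℕ) : ℝ :=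
  upperGamma (ν * r + 1) (β * t) / Real.Gamma (ν * r + 1) * (-(lam * j) / β ^ ν) ^ r

end FractionalYule

/-!
The proof rests on three computations.

*State probabilities.* Integrating the birth equations turns them into a triangular system of linear
fractional integral equations of order `ν`, in which uniqueness holds: a solution with zero data is
dominated by arbitrarily high iterates of the Riemann–Liouville integral, hence vanishes. The
alternating sums `∑ (n-1 choose j-1) (-1)^(j-1) E_ν(-λ j t^ν)` of Mittag-Leffler functions solve the
system, so they are the state probabilities.

*Age of the chosen webpage.* By induction on `m`, adding one independent exponential holding time at
a time, the expectation of `∑ h(T_k)` over the creation times `T_1, …, T_m`, on the event that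
`m + 1` webpages are present at time `t`, is the product of a factor depending on `m` only and of
the integral of `h` over `[0, t]` against `β exp (β s) ds`. Hence, whatever the number of webpages,
the age of the chosen webpage, given that it is not the initial one, has density proportional to
`exp (-β y)` on `[0, t]`. As the in-link processes are independent of the creation of the webpages,
`q_t(n)` is the integral of `p_n` against this density; integrating the Mittag-Leffler series term
by term gives the incomplete Gamma functions.

*Limit.* The Laplace transforms at `β` of the birth equations are the recursion that characterizes
the Yule–Simon probabilities of parameter `β^ν / λ`. Finally, the initial webpage is chosen with
probability `β t exp (-β t) / (1 - exp (-β t))`, which tends to `0`.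
-/

namespace FractionalYule

/-! ### Fractional integrals -/

lemma integral_sub_rpow_mul_rpow {a b T : ℝ} (ha : 0 < a) (hb : 0 < b) (hT : 0 < T) :
    ∫ x in (0 : ℝ)..T, (T - x) ^ (a - 1) * x ^ (b - 1) = T ^ (a + b - 1) * beta a b := by
  have hscaled := Complex.betaIntegral_scaled (b : ℂ) (a : ℂ) hT
  rw [Complex.betaIntegral_eq_Gamma_mul_div _ _ (by simpa) (by simpa)] at hscaled
  have hleft : ∫ x in (0 : ℝ)..T, (x : ℂ) ^ ((b : ℂ) - 1) * ((T : ℂ) - x) ^ ((a : ℂ) - 1)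
      = ((∫ x in (0 : ℝ)..T, (T - x) ^ (a - 1) * x ^ (b - 1) : ℝ) : ℂ) := by
    rw [← intervalIntegral.integral_ofReal]
    refine intervalIntegral.integral_congr fun x hx => ?_
    rw [Set.uIcc_of_le hT.le] at hx
    rw [Complex.ofReal_mul, Complex.ofReal_cpow hx.1, Complex.ofReal_cpow (sub_nonneg.2 hx.2),
      mul_comm]
    push_cast
    rfl
  have hright : (T : ℂ) ^ ((b : ℂ) + a - 1)
      * (Complex.Gamma b * Complex.Gamma a / Complex.Gamma (b + a))
      = ((T ^ (a + b - 1) * beta a b : ℝ) : ℂ) := by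
    rw [beta, Complex.ofReal_mul, Complex.ofReal_cpow hT.le, add_comm a]
    push_cast [← Complex.Gamma_ofReal]
    ring
  rw [hleft, hright] at hscaled
  exact_mod_cast hscaled

/-- The kernel `x ↦ x ^ (a - 1) / Γ(a)` of the Riemann–Liouville integral of order `a`, extended by
`0` to `x ≤ 0`, so that the fractional integral is a convolution over the whole line. -/
noncomputable def fracKernel (a : ℝ) : ℝ → ℝ :=
  (Set.Ioi 0).indicator fun x => x ^ (a - 1) / Real.Gamma a

lemma fracKernel_of_pos (a : ℝ) {x : ℝ} (hx : 0 < x) :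
    fracKernel a x = x ^ (a - 1) / Real.Gamma a :=
  Set.indicator_of_mem hx _

lemma fracKernel_of_nonpos (a : ℝ) {x : ℝ} (hx : x ≤ 0) : fracKernel a x = 0 :=
  Set.indicator_of_notMem hx.not_gt _

lemma fracKernel_sub_of_le (a : ℝ) {s t : ℝ} (h : t ≤ s) : fracKernel a (t - s) = 0 :=
  fracKernel_of_nonpos a (sub_nonpos.2 h)

lemma fracKernel_pos {a x : ℝ} (ha : 0 < a) (hx : 0 < x) : 0 < fracKernel a x := by
  rw [fracKernel_of_pos a hx]
  exact div_pos (Real.rpow_pos_of_pos hx _) (Real.Gamma_pos_of_pos ha)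

lemma fracKernel_nonneg {a : ℝ} (ha : 0 < a) (x : ℝ) : 0 ≤ fracKernel a x := by
  rcases le_or_gt x 0 with hx | hx
  · exact (fracKernel_of_nonpos a hx).ge
  · exact (fracKernel_pos ha hx).le

@[fun_prop]
lemma measurable_fracKernel (a : ℝ) : Measurable (fracKernel a) :=
  Measurable.indicator (by fun_prop) measurableSet_Ioi

lemma fracKernel_le {a x y : ℝ} (ha : 1 ≤ a) (hy : 0 ≤ y) (hxy : x ≤ y) :
    fracKernel a x ≤ y ^ (a - 1) / Real.Gamma a := by
  have : 0 ≤ Real.Gamma a := (Real.Gamma_pos_of_pos (zero_lt_one.trans_le ha)).le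
  rcases le_or_gt x 0 with hx | hx
  · rw [fracKernel_of_nonpos a hx]
    positivity
  · rw [fracKernel_of_pos a hx]
    gcongr

lemma fracKernel_mul_fracKernel_eq_indicator (a b x : ℝ) :
    (fun t => fracKernel a (x - t) * fracKernel b t) = (Set.Ioo 0 x).indicator fun t =>
      (Real.Gamma a * Real.Gamma b)⁻¹ * ((x - t) ^ (a - 1) * t ^ (b - 1)) := by
  funext t
  by_cases ht : t ∈ Set.Ioo 0 x
  · rw [Set.indicator_of_mem ht, fracKernel_of_pos a (sub_pos.2 ht.2), fracKernel_of_pos b ht.1]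
    ring
  · rw [Set.indicator_of_notMem ht]
    rcases le_or_gt t 0 with h | h
    · rw [fracKernel_of_nonpos b h, mul_zero]
    · have : x ≤ t := not_lt.1 fun hlt => ht ⟨h, hlt⟩
      rw [fracKernel_sub_of_le a this, zero_mul]

lemma integral_fracKernel_mul_fracKernel {a b : ℝ} (ha : 0 < a) (hb : 0 < b) (x : ℝ) :
    ∫ t, fracKernel a (x - t) * fracKernel b t = fracKernel (a + b) x := by
  rw [fracKernel_mul_fracKernel_eq_indicator, integral_indicator measurableSet_Ioo]
  rcases le_or_gt x 0 with hx | hx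
  · rw [Set.Ioo_eq_empty_of_le hx, Measure.restrict_empty, integral_zero_measure,
      fracKernel_of_nonpos _ hx]
  · have hΓa := (Real.Gamma_pos_of_pos ha).ne'
    have hΓb := (Real.Gamma_pos_of_pos hb).ne'
    rw [← integral_Ioc_eq_integral_Ioo, ← intervalIntegral.integral_of_le hx.le,
      intervalIntegral.integral_const_mul, integral_sub_rpow_mul_rpow ha hb hx,
      fracKernel_of_pos _ hx, beta]
    field_simp

lemma integrable_fracKernel_mul_fracKernel {a b : ℝ} (ha : 0 < a) (hb : 0 < b) (x : ℝ) :
    Integrable fun t => fracKernel a (x - t) * fracKernel b t := by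
  rcases le_or_gt x 0 with hx | hx
  · rw [fracKernel_mul_fracKernel_eq_indicator, Set.Ioo_eq_empty_of_le hx, Set.indicator_empty]
    exact integrable_zero _ _ _
  · refine Integrable.of_integral_ne_zero ?_
    rw [integral_fracKernel_mul_fracKernel ha hb]
    exact (fracKernel_pos (add_pos ha hb) hx).ne'

lemma integral_fracKernel_sub_mul_fracKernel_sub {a b : ℝ} (ha : 0 < a) (hb : 0 < b) (s x : ℝ) :
    ∫ t, fracKernel a (x - t) * fracKernel b (t - s) = fracKernel (a + b) (x - s) := by
  rw [← integral_fracKernel_mul_fracKernel ha hb (x - s),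
    ← integral_sub_right_eq_self (fun t => fracKernel a (x - s - t) * fracKernel b t) s]
  simp only [sub_sub_sub_cancel_right]

lemma integrable_fracKernel_sub_mul_fracKernel_sub {a b : ℝ} (ha : 0 < a) (hb : 0 < b) (s x : ℝ) :
    Integrable fun t => fracKernel a (x - t) * fracKernel b (t - s) := by
  simpa only [sub_sub_sub_cancel_right]
    using (integrable_fracKernel_mul_fracKernel ha hb (x - s)).comp_sub_right s

/-- The Riemann–Liouville integral of order `ν`, with base point `0`. -/
noncomputable def fracIntegral (ν : ℝ) (f : ℝ → ℝ) (t : ℝ) : ℝ :=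
  ∫ s in (0 : ℝ)..t, fracKernel ν (t - s) * f s

lemma fracIntegral_of_nonpos (ν : ℝ) (f : ℝ → ℝ) {t : ℝ} (ht : t ≤ 0) :
    fracIntegral ν f t = 0 := by
  rw [fracIntegral, intervalIntegral.integral_of_ge ht, neg_eq_zero]
  refine setIntegral_eq_zero_of_forall_eq_zero fun s hs => ?_
  rw [fracKernel_sub_of_le ν hs.1.le, zero_mul]

lemma fracIntegral_eq_integral (ν : ℝ) {f g : ℝ → ℝ} {t : ℝ} (hg : ∀ s ≤ 0, g s = 0)
    (hfg : ∀ s ∈ Set.Ioc 0 t, f s = g s) :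
    fracIntegral ν f t = ∫ s, fracKernel ν (t - s) * g s := by
  have hsupp : ∀ s ∉ Set.Ioc 0 t, fracKernel ν (t - s) * g s = 0 := fun s hs => by
    rcases le_or_gt s 0 with h | h
    · rw [hg s h, mul_zero]
    · rw [fracKernel_sub_of_le ν (not_le.1 fun hle => hs ⟨h, hle⟩).le, zero_mul]
  rw [← setIntegral_eq_integral_of_forall_compl_eq_zero hsupp]
  rcases le_or_gt t 0 with ht | ht
  · rw [fracIntegral_of_nonpos ν f ht, Set.Ioc_eq_empty_of_le ht, Measure.restrict_empty,
      integral_zero_measure]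
  · rw [fracIntegral, intervalIntegral.integral_of_le ht.le]
    exact setIntegral_congr_fun measurableSet_Ioc fun s hs => by simp only [hfg s hs]

lemma fracIntegral_congr (ν : ℝ) {f g : ℝ → ℝ} {t : ℝ} (ht : 0 ≤ t)
    (h : ∀ s ∈ Set.Ioc 0 t, f s = g s) : fracIntegral ν f t = fracIntegral ν g t := by
  refine intervalIntegral.integral_congr_ae (Eventually.of_forall fun s hs => ?_)
  rw [h s (Set.uIoc_of_le ht ▸ hs)]

lemma fracIntegral_one (f : ℝ → ℝ) {t : ℝ} (ht : 0 ≤ t) :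
    fracIntegral 1 f t = ∫ s in (0 : ℝ)..t, f s := by
  rw [fracIntegral, intervalIntegral.integral_of_le ht, intervalIntegral.integral_of_le ht,
    integral_Ioc_eq_integral_Ioo, integral_Ioc_eq_integral_Ioo]
  refine setIntegral_congr_fun measurableSet_Ioo fun s hs => ?_
  simp only [fracKernel_of_pos 1 (sub_pos.2 hs.2), sub_self, Real.rpow_zero, Real.Gamma_one,
    div_one, one_mul]

lemma integrable_prod_fracKernel_mul_fracKernel_mul {a b T : ℝ} (ha : 0 < a) (hb : 0 < b)
    (hab : 1 ≤ a + b) (hT : 0 ≤ T) {g : ℝ → ℝ} (hg : Integrable g) (hg0 : ∀ s ≤ 0, g s = 0) :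
    Integrable (fun z : ℝ × ℝ => fracKernel a (T - z.2) * fracKernel b (z.2 - z.1) * g z.1)
      (volume.prod volume) := by
  have hmeas : AEStronglyMeasurable
      (fun z : ℝ × ℝ => fracKernel a (T - z.2) * fracKernel b (z.2 - z.1) * g z.1)
      (volume.prod volume) :=
    (Measurable.aestronglyMeasurable (by fun_prop)).mul hg.aestronglyMeasurable.comp_fst
  refine (integrable_prod_iff hmeas).2 ⟨Eventually.of_forall fun s =>
    (integrable_fracKernel_sub_mul_fracKernel_sub ha hb s T).mul_const (g s), ?_⟩
  have hnorm : ∀ s, ∫ t, ‖fracKernel a (T - t) * fracKernel b (t - s) * g s‖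
      = fracKernel (a + b) (T - s) * ‖g s‖ := fun s => by
    rw [← integral_fracKernel_sub_mul_fracKernel_sub ha hb s T, ← integral_mul_const]
    congr 1 with t
    rw [norm_mul, Real.norm_of_nonneg
      (mul_nonneg (fracKernel_nonneg ha _) (fracKernel_nonneg hb _))]
  simp only [hnorm]
  refine (hg.norm.const_mul (T ^ (a + b - 1) / Real.Gamma (a + b))).mono'
    ((by fun_prop : Measurable fun s => fracKernel (a + b) (T - s)).aestronglyMeasurable.mul
      hg.aestronglyMeasurable.norm) (Eventually.of_forall fun s => ?_)
  rcases le_or_gt s 0 with hs | hs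
  · simp [hg0 s hs]
  · rw [norm_mul, norm_norm, Real.norm_of_nonneg (fracKernel_nonneg (add_pos ha hb) _)]
    exact mul_le_mul_of_nonneg_right (fracKernel_le hab hT (by linarith)) (norm_nonneg _)

-- The hypothesis `1 ≤ a + b` makes the kernel of order `a + b` bounded, so that the right-hand
-- side converges at every `T` and not only at almost every one.
theorem fracIntegral_fracIntegral {a b T : ℝ} (ha : 0 < a) (hb : 0 < b) (hab : 1 ≤ a + b)
    (hT : 0 ≤ T) {f : ℝ → ℝ} (hf : IntervalIntegrable f volume 0 T) :
    fracIntegral a (fracIntegral b f) T = fracIntegral (a + b) f T := by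
  set g := (Set.Ioc 0 T).indicator f
  have hg : Integrable g :=
    ((intervalIntegrable_iff_integrableOn_Ioc_of_le hT).1 hf).integrable_indicator measurableSet_Ioc
  have hg0 : ∀ s ≤ 0, g s = 0 := fun s hs => Set.indicator_of_notMem (fun h => hs.not_gt h.1) _
  have hfg : ∀ s ∈ Set.Ioc 0 T, f s = g s := fun s hs => (Set.indicator_of_mem hs f).symm
  have hinner : ∀ t, fracKernel a (T - t) * fracIntegral b f t
      = ∫ s, fracKernel a (T - t) * fracKernel b (t - s) * g s := fun t => by
    simp only [mul_assoc, integral_const_mul]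
    rcases le_or_gt T t with ht | ht
    · rw [fracKernel_sub_of_le a ht, zero_mul, zero_mul]
    · rw [fracIntegral_eq_integral b hg0 fun s hs => hfg s ⟨hs.1, hs.2.trans ht.le⟩]
  calc fracIntegral a (fracIntegral b f) T
      = ∫ t, ∫ s, fracKernel a (T - t) * fracKernel b (t - s) * g s := by
        rw [fracIntegral_eq_integral a (fun t ht => fracIntegral_of_nonpos b f ht) fun _ _ => rfl]
        simp only [hinner]
    _ = ∫ s, ∫ t, fracKernel a (T - t) * fracKernel b (t - s) * g s :=
        (integral_integral_swap
          (integrable_prod_fracKernel_mul_fracKernel_mul ha hb hab hT hg hg0)).symm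
    _ = fracIntegral (a + b) f T := by
        rw [fracIntegral_eq_integral _ hg0 hfg]
        simp only [integral_mul_const, integral_fracKernel_sub_mul_fracKernel_sub ha hb]

lemma caputoDeriv_eq_fracIntegral (ν : ℝ) (f : ℝ → ℝ) {t : ℝ} (ht : 0 ≤ t) :
    caputoDeriv ν f t = fracIntegral (1 - ν) (deriv f) t := by
  rw [caputoDeriv, fracIntegral, ← intervalIntegral.integral_const_mul,
    intervalIntegral.integral_of_le ht, intervalIntegral.integral_of_le ht,
    integral_Ioc_eq_integral_Ioo, integral_Ioc_eq_integral_Ioo]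
  refine setIntegral_congr_fun measurableSet_Ioo fun s hs => ?_
  have hts : 0 < t - s := sub_pos.2 hs.2
  simp only [fracKernel_of_pos _ hts, show 1 - ν - 1 = -ν by ring, Real.rpow_neg hts.le]
  ring

theorem fracIntegral_caputoDeriv {ν T : ℝ} (hν0 : 0 < ν) (hν1 : ν < 1) (hT : 0 ≤ T) {f : ℝ → ℝ}
    (hf : AbsolutelyContinuousOnInterval f 0 T) :
    fracIntegral ν (caputoDeriv ν f) T = f T - f 0 := by
  rw [fracIntegral_congr ν hT fun t ht => caputoDeriv_eq_fracIntegral ν f ht.1.le,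
    fracIntegral_fracIntegral hν0 (sub_pos.2 hν1) (by simp) hT hf.intervalIntegrable_deriv,
    add_sub_cancel, fracIntegral_one _ hT, hf.integral_deriv_eq_sub]

lemma intervalIntegrable_fracKernel_sub {ν t : ℝ} (hν : 0 < ν) (ht : 0 ≤ t) :
    IntervalIntegrable (fun s => fracKernel ν (t - s)) volume 0 t := by
  rw [intervalIntegrable_iff_integrableOn_Ioc_of_le ht]
  refine ((integrable_fracKernel_mul_fracKernel hν one_pos t).integrableOn).congr_fun
    (fun s hs => ?_) measurableSet_Ioc
  simp [fracKernel_of_pos 1 hs.1]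

lemma intervalIntegrable_fracKernel_mul {ν t : ℝ} (hν : 0 < ν) (ht : 0 ≤ t) {f : ℝ → ℝ}
    (hf : ContinuousOn f (Set.Icc 0 t)) :
    IntervalIntegrable (fun s => fracKernel ν (t - s) * f s) volume 0 t :=
  (intervalIntegrable_fracKernel_sub hν ht).mul_continuousOn (Set.uIcc_of_le ht ▸ hf)

lemma fracIntegral_fracKernel {ν a : ℝ} (hν : 0 < ν) (ha : 0 < a) (t : ℝ) :
    fracIntegral ν (fracKernel a) t = fracKernel (ν + a) t := by
  rw [fracIntegral_eq_integral ν (fun s hs => fracKernel_of_nonpos a hs) fun _ _ => rfl,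
    integral_fracKernel_mul_fracKernel hν ha]

lemma fracIntegral_sub {ν t : ℝ} (hν : 0 < ν) (ht : 0 ≤ t) {f g : ℝ → ℝ}
    (hf : ContinuousOn f (Set.Icc 0 t)) (hg : ContinuousOn g (Set.Icc 0 t)) :
    fracIntegral ν (fun s => f s - g s) t = fracIntegral ν f t - fracIntegral ν g t := by
  simp only [fracIntegral, mul_sub]
  exact intervalIntegral.integral_sub (intervalIntegrable_fracKernel_mul hν ht hf)
    (intervalIntegrable_fracKernel_mul hν ht hg)

lemma fracIntegral_const_mul (ν c t : ℝ) (f : ℝ → ℝ) :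
    fracIntegral ν (fun s => c * f s) t = c * fracIntegral ν f t := by
  simp only [fracIntegral, mul_left_comm _ c, intervalIntegral.integral_const_mul]

lemma fracIntegral_finset_sum {ι : Type*} {ν t : ℝ} (hν : 0 < ν) (ht : 0 ≤ t) (s : Finset ι)
    {f : ι → ℝ → ℝ} (hf : ∀ i ∈ s, ContinuousOn (f i) (Set.Icc 0 t)) :
    fracIntegral ν (fun x => ∑ i ∈ s, f i x) t = ∑ i ∈ s, fracIntegral ν (f i) t := by
  simp only [fracIntegral, Finset.mul_sum]
  exact intervalIntegral.integral_finsetSum fun i hi =>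
    intervalIntegrable_fracKernel_mul hν ht (hf i hi)

lemma abs_fracIntegral_le {ν t : ℝ} (hν : 0 < ν) (ht : 0 ≤ t) {f g : ℝ → ℝ}
    (hg : IntervalIntegrable (fun s => fracKernel ν (t - s) * g s) volume 0 t)
    (h : ∀ s ∈ Set.Ioc 0 t, |f s| ≤ g s) : |fracIntegral ν f t| ≤ fracIntegral ν g t := by
  refine intervalIntegral.norm_integral_le_of_norm_le (E := ℝ) ht
    (Eventually.of_forall fun s hs => ?_) hg
  rw [norm_mul, Real.norm_of_nonneg (fracKernel_nonneg hν _)]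
  exact mul_le_mul_of_nonneg_left (h s hs) (fracKernel_nonneg hν _)

/-! ### Mittag-Leffler functions -/

lemma rpow_mul_exp_neg_le_Gamma {R s : ℝ} (hR : 0 < R) (hs : 1 ≤ s) :
    R ^ (s - 1) * Real.exp (-R) ≤ Real.Gamma s := by
  rw [Real.Gamma_eq_integral (zero_lt_one.trans_le hs)]
  have hint := Real.GammaIntegral_convergent (zero_lt_one.trans_le hs)
  calc R ^ (s - 1) * Real.exp (-R) = ∫ x in Set.Ioi R, Real.exp (-x) * R ^ (s - 1) := by
        rw [integral_mul_const, integral_exp_neg_Ioi, mul_comm]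
    _ ≤ ∫ x in Set.Ioi R, Real.exp (-x) * x ^ (s - 1) := by
        refine setIntegral_mono_on ((integrableOn_exp_neg_Ioi R).mul_const _)
          (hint.mono_set (Set.Ioi_subset_Ioi hR.le)) measurableSet_Ioi fun x hx => ?_
        exact mul_le_mul_of_nonneg_left
          (Real.rpow_le_rpow hR.le (le_of_lt hx) (sub_nonneg.2 hs)) (Real.exp_pos _).le
    _ ≤ ∫ x in Set.Ioi 0, Real.exp (-x) * x ^ (s - 1) := by
        refine setIntegral_mono_set hint ?_ (Set.Ioi_subset_Ioi hR.le).eventuallyLE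
        refine (ae_restrict_mem measurableSet_Ioi).mono fun x hx => ?_
        exact mul_nonneg (Real.exp_pos _).le (Real.rpow_nonneg (le_of_lt hx) _)

lemma Gamma_mul_natCast_add_one_pos {ν : ℝ} (hν : 0 < ν) (r : ℕ) : 0 < Real.Gamma (ν * r + 1) :=
  Real.Gamma_pos_of_pos (by positivity)

lemma summable_pow_div_Gamma {ν : ℝ} (hν : 0 < ν) (z : ℝ) :
    Summable fun r : ℕ => z ^ r / Real.Gamma (ν * r + 1) := by
  -- `R` is chosen with `R ^ ν = 2 (|z| + 1)`, so that `Γ(ν r + 1) ≥ R ^ (ν r) exp (-R)` makes the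
  -- series geometric of ratio at most `1 / 2`.
  set R : ℝ := (2 * (|z| + 1)) ^ ν⁻¹
  have hR : 0 < R := Real.rpow_pos_of_pos (by positivity) _
  have hRν : R ^ ν = 2 * (|z| + 1) := Real.rpow_inv_rpow (by positivity) hν.ne'
  refine Summable.of_norm_bounded (summable_geometric_two.mul_left (Real.exp R)) fun r => ?_
  have hΓ := Gamma_mul_natCast_add_one_pos hν r
  have hΓge : (2 * (|z| + 1)) ^ r * Real.exp (-R) ≤ Real.Gamma (ν * r + 1) := by
    have := rpow_mul_exp_neg_le_Gamma (s := ν * r + 1) hR (le_add_of_nonneg_left (by positivity))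
    rwa [add_sub_cancel_right, Real.rpow_mul hR.le, hRν, Real.rpow_natCast] at this
  rw [norm_div, norm_pow, Real.norm_eq_abs, Real.norm_of_nonneg hΓ.le, div_le_iff₀ hΓ]
  calc |z| ^ r ≤ (|z| + 1) ^ r := pow_le_pow_left₀ (abs_nonneg z) (by linarith) r
    _ = Real.exp R * (1 / 2) ^ r * ((2 * (|z| + 1)) ^ r * Real.exp (-R)) := by
        rw [Real.exp_neg, mul_pow, one_div, inv_pow]
        field_simp
    _ ≤ _ := mul_le_mul_of_nonneg_left hΓge (by positivity)

/-- The Mittag-Leffler function `E_ν`, the eigenfunctions `t ↦ E_ν(c t ^ ν)` of the Caputo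
derivative of order `ν` being built on it. -/
noncomputable def mittagLeffler (ν z : ℝ) : ℝ := ∑' r : ℕ, z ^ r / Real.Gamma (ν * r + 1)

lemma continuous_mittagLeffler {ν : ℝ} (hν : 0 < ν) : Continuous (mittagLeffler ν) := by
  refine continuous_iff_continuousAt.2 fun z => ?_
  refine ContinuousOn.continuousAt (s := Metric.closedBall 0 (‖z‖ + 1)) ?_
    (Filter.mem_of_superset (Metric.ball_mem_nhds z one_pos) fun w hw => ?_)
  · refine continuousOn_tsum (fun r => by fun_prop) (summable_pow_div_Gamma hν (‖z‖ + 1))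
      fun r w hw => ?_
    rw [norm_div, norm_pow, Real.norm_of_nonneg (Gamma_mul_natCast_add_one_pos hν r).le]
    gcongr
    exact mem_closedBall_zero_iff.1 hw
  · rw [mem_closedBall_zero_iff]
    linarith [norm_le_norm_add_norm_sub' w z, mem_ball_iff_norm.1 hw]

lemma continuous_mittagLeffler_const_mul_rpow {ν : ℝ} (hν : 0 < ν) (c : ℝ) :
    Continuous fun t : ℝ => mittagLeffler ν (c * t ^ ν) :=
  (continuous_mittagLeffler hν).comp ((Real.continuous_rpow_const hν.le).const_mul c)

lemma pow_mul_fracKernel {t : ℝ} (ht : 0 < t) (ν c : ℝ) (r : ℕ) :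
    c ^ r * fracKernel (ν * r + 1) t = (c * t ^ ν) ^ r / Real.Gamma (ν * r + 1) := by
  rw [fracKernel_of_pos _ ht, add_sub_cancel_right, Real.rpow_mul ht.le, Real.rpow_natCast, mul_pow,
    mul_div_assoc]

lemma mittagLeffler_eq_tsum_fracKernel (ν c : ℝ) {t : ℝ} (ht : 0 < t) :
    mittagLeffler ν (c * t ^ ν) = ∑' r : ℕ, c ^ r * fracKernel (ν * r + 1) t :=
  tsum_congr fun r => (pow_mul_fracKernel ht ν c r).symm

lemma summable_pow_mul_fracKernel {ν : ℝ} (hν : 0 < ν) (c : ℝ) {t : ℝ} (ht : 0 < t) :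
    Summable fun r : ℕ => c ^ r * fracKernel (ν * r + 1) t :=
  (summable_pow_div_Gamma hν (c * t ^ ν)).congr fun r => (pow_mul_fracKernel ht ν c r).symm

lemma fracKernel_mul_natCast_add_one_mono {ν : ℝ} (hν : 0 < ν) (r : ℕ) :
    Monotone (fracKernel (ν * r + 1)) := fun s t hst => by
  rcases le_or_gt t 0 with ht | ht
  · rw [fracKernel_of_nonpos _ ht, fracKernel_of_nonpos _ (hst.trans ht)]
  · exact (fracKernel_le (le_add_of_nonneg_left (by positivity)) ht.le hst).trans_eq
      (fracKernel_of_pos _ ht).symm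

lemma hasSum_integral_mul_fracKernel {ν : ℝ} (hν : 0 < ν) (c : ℝ) {t : ℝ} (ht : 0 < t) {w : ℝ → ℝ}
    (hw : IntervalIntegrable w volume 0 t) :
    HasSum (fun r : ℕ => c ^ r * ∫ s in (0 : ℝ)..t, w s * fracKernel (ν * r + 1) s)
      (∫ s in (0 : ℝ)..t, w s * mittagLeffler ν (c * s ^ ν)) := by
  simp only [← intervalIntegral.integral_const_mul, mul_left_comm (c ^ _) (w _)]
  refine intervalIntegral.hasSum_integral_of_dominated_convergence
    (fun r s => ‖w s‖ * (|c| ^ r * fracKernel (ν * r + 1) t)) (fun r => ?_)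
    (fun r => Eventually.of_forall fun s hs => ?_) (Eventually.of_forall fun s _ => ?_) ?_
    (Eventually.of_forall fun s hs => ?_)
  · exact hw.def'.aestronglyMeasurable.mul (Measurable.aestronglyMeasurable (by fun_prop))
  · rw [Set.uIoc_of_le ht.le] at hs
    rw [norm_mul, norm_mul, norm_pow, Real.norm_eq_abs c,
      Real.norm_of_nonneg (fracKernel_nonneg (by positivity) s)]
    gcongr
    exact fracKernel_mul_natCast_add_one_mono hν r hs.2
  · exact (summable_pow_mul_fracKernel hν |c| ht).mul_left _
  · simp only [tsum_mul_left]
    exact hw.norm.mul_const _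
  · rw [Set.uIoc_of_le ht.le] at hs
    rw [mittagLeffler_eq_tsum_fracKernel ν c hs.1]
    exact (summable_pow_mul_fracKernel hν c hs.1).hasSum.mul_left _

lemma const_mul_fracIntegral_mittagLeffler {ν : ℝ} (hν : 0 < ν) (c : ℝ) {t : ℝ} (ht : 0 < t) :
    c * fracIntegral ν (fun s => mittagLeffler ν (c * s ^ ν)) t
      = mittagLeffler ν (c * t ^ ν) - 1 := by
  have hsum := (hasSum_integral_mul_fracKernel hν c ht
    (intervalIntegrable_fracKernel_sub hν ht.le)).mul_left c
  have hshift := (summable_pow_mul_fracKernel hν c ht).tsum_eq_zero_add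
  rw [← mittagLeffler_eq_tsum_fracKernel ν c ht] at hshift
  rw [hshift, fracIntegral, ← hsum.tsum_eq, Nat.cast_zero, mul_zero, zero_add,
    fracKernel_of_pos 1 ht, sub_self, Real.rpow_zero, Real.Gamma_one, div_one, pow_zero, one_mul,
    add_sub_cancel_left]
  refine tsum_congr fun r => ?_
  have hstep := fracIntegral_fracKernel hν (show 0 < ν * r + 1 by positivity) t
  rw [fracIntegral] at hstep
  rw [hstep, ← mul_assoc, ← pow_succ', Nat.cast_succ]
  ring_nf

lemma abs_le_of_eq_const_mul_fracIntegral {ν c M T : ℝ} (hν : 0 < ν) {f : ℝ → ℝ}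
    (hf : ∀ t ∈ Set.Ioc 0 T, f t = c * fracIntegral ν f t) (hM : ∀ t ∈ Set.Ioc 0 T, |f t| ≤ M)
    (k : ℕ) : ∀ t ∈ Set.Ioc 0 T, |f t| ≤ M * (|c| ^ k * fracKernel (ν * k + 1) t) := by
  induction k with
  | zero =>
    intro t ht
    simpa [fracKernel_of_pos 1 ht.1] using hM t ht
  | succ k ih =>
    intro t ht
    have hk : 0 < ν * k + 1 := by positivity
    have hint : IntervalIntegrable
        (fun s => fracKernel ν (t - s) * (M * |c| ^ k * fracKernel (ν * k + 1) s)) volume 0 t := by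
      simpa only [mul_left_comm] using
        ((integrable_fracKernel_mul_fracKernel hν hk t).const_mul (M * |c| ^ k)).intervalIntegrable
    calc |f t| = |c| * |fracIntegral ν f t| := by rw [hf t ht, abs_mul]
      _ ≤ |c| * fracIntegral ν (fun s => M * |c| ^ k * fracKernel (ν * k + 1) s) t := by
          refine mul_le_mul_of_nonneg_left (abs_fracIntegral_le hν ht.1.le hint fun s hs => ?_)
            (abs_nonneg c)
          rw [mul_assoc]
          exact ih s ⟨hs.1, hs.2.trans ht.2⟩
      _ = M * (|c| ^ (k + 1) * fracKernel (ν * (k + 1 : ℕ) + 1) t) := by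
          rw [fracIntegral_const_mul, fracIntegral_fracKernel hν hk]
          push_cast
          ring_nf

theorem eq_zero_of_eq_const_mul_fracIntegral {ν c T : ℝ} (hν : 0 < ν) {f : ℝ → ℝ}
    (hf : ∀ t ∈ Set.Ioc 0 T, f t = c * fracIntegral ν f t)
    (hbdd : ∃ M, ∀ t ∈ Set.Ioc 0 T, |f t| ≤ M) : ∀ t ∈ Set.Ioc 0 T, f t = 0 := by
  obtain ⟨M, hM⟩ := hbdd
  intro t ht
  have hlim := (summable_pow_mul_fracKernel hν |c| ht.1).tendsto_atTop_zero.const_mul M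
  rw [mul_zero] at hlim
  exact abs_nonpos_iff.1 <| ge_of_tendsto' hlim fun k =>
    abs_le_of_eq_const_mul_fracIntegral hν hf hM k t ht

/-! ### The fractional linear birth equations -/

/-- The state probabilities of the fractional linear birth process of rates `lam * r` started from
one individual, as alternating sums of Mittag-Leffler functions. -/
noncomputable def linearBirthProb (ν lam : ℝ) (n : ℕ) (t : ℝ) : ℝ :=
  ∑ j ∈ Finset.range n,
    ((n - 1).choose j : ℝ) * (-1) ^ j * mittagLeffler ν (-(lam * (j + 1)) * t ^ ν)

lemma continuous_linearBirthProb {ν : ℝ} (hν : 0 < ν) (lam : ℝ) (n : ℕ) :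
    Continuous (linearBirthProb ν lam n) :=
  continuous_finsetSum _ fun _ _ => (continuous_mittagLeffler_const_mul_rpow hν _).const_mul _

lemma sum_range_choose_mul_neg_one_pow (n : ℕ) :
    ∑ j ∈ Finset.range (n + 1), (n.choose j : ℝ) * (-1) ^ j = if n = 0 then 1 else 0 := by
  have h := congrArg (Int.cast (R := ℝ)) (Int.alternating_sum_range_choose (n := n))
  push_cast at h
  simpa only [mul_comm] using h

lemma sum_choose_mul_rate_recurrence (lam : ℝ) (n : ℕ) (e : ℕ → ℝ) :
    -(lam * (n + 1)) * ∑ j ∈ Finset.range (n + 1), (n.choose j : ℝ) * (-1) ^ j * e j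
        + lam * n * ∑ j ∈ Finset.range n, ((n - 1).choose j : ℝ) * (-1) ^ j * e j
      = ∑ j ∈ Finset.range (n + 1), (n.choose j : ℝ) * (-1) ^ j * (-(lam * (j + 1)) * e j) := by
  cases n with
  | zero => simp
  | succ n =>
    have hextend : ∑ j ∈ Finset.range (n + 1), (n.choose j : ℝ) * (-1) ^ j * e j
        = ∑ j ∈ Finset.range (n + 1 + 1), (n.choose j : ℝ) * (-1) ^ j * e j := by
      simp [Finset.sum_range_succ _ (n + 1)]
    rw [Nat.add_sub_cancel, hextend, Finset.mul_sum, Finset.mul_sum, ← Finset.sum_add_distrib]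
    refine Finset.sum_congr rfl fun j hj => ?_
    have habsorb : (n.choose j : ℝ) * (n + 1) = ((n + 1).choose j : ℝ) * (n + 1 - j) := by
      have := congrArg (Nat.cast (R := ℝ)) (Nat.choose_mul_succ_eq n j)
      rw [Nat.cast_mul, Nat.cast_mul, Nat.cast_sub (Finset.mem_range_succ_iff.1 hj)] at this
      exact_mod_cast this
    push_cast
    linear_combination lam * (-1) ^ j * e j * habsorb

theorem linearBirthProb_succ {ν : ℝ} (hν : 0 < ν) (lam : ℝ) (n : ℕ) {t : ℝ} (ht : 0 < t) :
    linearBirthProb ν lam (n + 1) t = (if n = 0 then 1 else 0)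
      + fracIntegral ν (fun s => -(lam * (n + 1)) * linearBirthProb ν lam (n + 1) s
          + lam * n * linearBirthProb ν lam n s) t := by
  have hcont : ∀ j ∈ Finset.range (n + 1), ContinuousOn (fun s : ℝ =>
      (n.choose j : ℝ) * (-1) ^ j * (-(lam * (j + 1)) * mittagLeffler ν (-(lam * (j + 1)) * s ^ ν)))
      (Set.Icc 0 t) := fun j _ =>
    (((continuous_mittagLeffler_const_mul_rpow hν _).const_mul _).const_mul _).continuousOn
  simp only [linearBirthProb, Nat.add_sub_cancel, sum_choose_mul_rate_recurrence]
  rw [fracIntegral_finset_sum hν ht.le _ hcont, ← sum_range_choose_mul_neg_one_pow n,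
    ← Finset.sum_add_distrib]
  refine Finset.sum_congr rfl fun j _ => ?_
  rw [fracIntegral_const_mul, fracIntegral_const_mul, const_mul_fracIntegral_mittagLeffler hν _ ht]
  ring

/-! ### Incomplete Gamma functions -/

section IncompleteGamma

variable {β ν lam t : ℝ}

lemma integral_exp_mul_fracKernel (hβ : 0 < β) (a : ℝ) (ht : 0 ≤ t) :
    ∫ y in (0 : ℝ)..t, Real.exp (-β * y) * fracKernel a y
      = lowerGamma a (β * t) / Real.Gamma a * β ^ (-a) := by
  have hscale : lowerGamma a (β * t)
      = β * ∫ y in (0 : ℝ)..t, (β * y) ^ (a - 1) * Real.exp (-(β * y)) := by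
    rw [intervalIntegral.integral_comp_mul_left (fun u => u ^ (a - 1) * Real.exp (-u)) hβ.ne',
      mul_zero, smul_eq_mul, mul_inv_cancel_left₀ hβ.ne', lowerGamma]
  rw [hscale, mul_div_assoc, mul_right_comm, mul_div_assoc', ← intervalIntegral.integral_const_mul,
    ← intervalIntegral.integral_div, intervalIntegral.integral_of_le ht,
    intervalIntegral.integral_of_le ht]
  refine setIntegral_congr_fun measurableSet_Ioc fun y hy => ?_
  simp only [fracKernel_of_pos a hy.1, Real.mul_rpow hβ.le hy.1.le, Real.rpow_sub_one hβ.ne',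
    Real.rpow_neg hβ.le, neg_mul]
  have := (Real.rpow_pos_of_pos hβ a).ne'
  field_simp

lemma hasSum_lowerTerm (hβ : 0 < β) (hν : 0 < ν) (ht : 0 < t) (j : ℕ) :
    HasSum (lowerTerm β ν lam t j)
      (∫ y in (0 : ℝ)..t, β * Real.exp (-β * y) * mittagLeffler ν (-(lam * j) * y ^ ν)) := by
  refine (hasSum_integral_mul_fracKernel hν (-(lam * j)) ht
    (w := fun y => β * Real.exp (-β * y))
    (Continuous.intervalIntegrable (by fun_prop) _ _)).congr_fun fun r => ?_
  simp only [mul_assoc β]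
  rw [intervalIntegral.integral_const_mul, integral_exp_mul_fracKernel hβ _ ht.le, lowerTerm,
    div_pow, Real.rpow_neg hβ.le, Real.rpow_add_one hβ.ne', Real.rpow_mul hβ.le, Real.rpow_natCast]
  field_simp

lemma lowerGamma_add_upperGamma {a x : ℝ} (ha : 0 < a) (hx : 0 ≤ x) :
    lowerGamma a x + upperGamma a x = Real.Gamma a := by
  have hint : IntegrableOn (fun u => u ^ (a - 1) * Real.exp (-u)) (Set.Ioi 0) := by
    simpa only [mul_comm] using Real.GammaIntegral_convergent ha
  rw [Real.Gamma_eq_integral ha, lowerGamma, upperGamma, intervalIntegral.integral_of_le hx,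
    ← setIntegral_union (Set.Ioc_disjoint_Ioi le_rfl) measurableSet_Ioi
      (hint.mono_set Set.Ioc_subset_Ioi_self) (hint.mono_set (Set.Ioi_subset_Ioi hx)),
    Set.Ioc_union_Ioi_eq_Ioi hx]
  simp only [mul_comm]

lemma upperTerm_eq (hβ : 0 < β) (hν : 0 < ν) (ht : 0 < t) (j r : ℕ) :
    upperTerm β ν lam t j r = (-(lam * j) / β ^ ν) ^ r - lowerTerm β ν lam t j r := by
  have hsplit := lowerGamma_add_upperGamma (a := ν * r + 1) (x := β * t) (by positivity)
    (by positivity)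
  rw [upperTerm, lowerTerm, eq_sub_iff_add_eq'.2 hsplit, sub_div,
    div_self (Gamma_mul_natCast_add_one_pos hν r).ne']
  ring

lemma abs_neg_mul_div_lt_one_iff (hβ : 0 < β) (hlam : 0 < lam) (j : ℕ) :
    |-(lam * j) / β ^ ν| < 1 ↔ lam * j < β ^ ν := by
  have hβν := Real.rpow_pos_of_pos hβ ν
  rw [abs_div, abs_neg, abs_of_pos hβν, abs_of_nonneg (by positivity), div_lt_one hβν]

lemma summable_upperTerm_iff (hβ : 0 < β) (hν : 0 < ν) (hlam : 0 < lam) (ht : 0 < t) (j : ℕ) :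
    Summable (upperTerm β ν lam t j) ↔ lam * j < β ^ ν := by
  have hlower := (hasSum_lowerTerm (lam := lam) hβ hν ht j).summable
  rw [← abs_neg_mul_div_lt_one_iff hβ hlam, ← Real.norm_eq_abs,
    ← summable_geometric_iff_norm_lt_one]
  refine ⟨fun h => (h.add hlower).congr fun r => ?_, fun h => (h.sub hlower).congr fun r => ?_⟩
  · rw [upperTerm_eq hβ hν ht, sub_add_cancel]
  · rw [upperTerm_eq hβ hν ht]

lemma tsum_upperTerm (hβ : 0 < β) (hν : 0 < ν) (hlam : 0 < lam) (ht : 0 < t) {j : ℕ}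
    (hj : lam * j < β ^ ν) :
    ∑' r, upperTerm β ν lam t j r
      = β ^ ν / lam / (β ^ ν / lam + j) - ∑' r, lowerTerm β ν lam t j r := by
  have hratio := (abs_neg_mul_div_lt_one_iff hβ hlam j).2 hj
  have : 0 < β ^ ν / lam := div_pos (Real.rpow_pos_of_pos hβ ν) hlam
  simp only [upperTerm_eq hβ hν ht]
  rw [(summable_geometric_of_abs_lt_one hratio).tsum_sub (hasSum_lowerTerm hβ hν ht j).summable,
    tsum_geometric_of_abs_lt_one hratio]
  congr 1
  field_simp
  rw [sub_neg_eq_add, div_self (by positivity)]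

end IncompleteGamma

/-! ### Laplace transforms -/

lemma integral_Ioi_exp_mul_fracKernel {β a : ℝ} (hβ : 0 < β) (ha : 0 < a) :
    ∫ y in Set.Ioi 0, Real.exp (-β * y) * fracKernel a y = (β ^ a)⁻¹ := by
  have hΓ := (Real.Gamma_pos_of_pos ha).ne'
  calc ∫ y in Set.Ioi 0, Real.exp (-β * y) * fracKernel a y
      = ∫ y in Set.Ioi 0, (Real.Gamma a)⁻¹ * (y ^ (a - 1) * Real.exp (-(β * y))) := by
        refine setIntegral_congr_fun measurableSet_Ioi fun y hy => ?_
        simp only [fracKernel_of_pos a hy, neg_mul]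
        ring
    _ = (β ^ a)⁻¹ := by
        rw [integral_const_mul, Real.integral_rpow_mul_exp_neg_mul_Ioi ha hβ, one_div,
          Real.inv_rpow hβ.le]
        field_simp

lemma integrableOn_exp_mul_fracKernel {β a : ℝ} (hβ : 0 < β) (ha : 0 < a) :
    IntegrableOn (fun y => Real.exp (-β * y) * fracKernel a y) (Set.Ioi 0) :=
  Integrable.of_integral_ne_zero <| by
    rw [integral_Ioi_exp_mul_fracKernel hβ ha]
    positivity

lemma posConvolution_exp_mul_fracKernel (β ν : ℝ) (f : ℝ → ℝ) :
    posConvolution (fun s => Real.exp (-β * s) * f s)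
        (fun s => Real.exp (-β * s) * fracKernel ν s) (ContinuousLinearMap.mul ℝ ℝ) volume
      = (Set.Ioi 0).indicator fun t => Real.exp (-β * t) * fracIntegral ν f t := by
  refine congrArg _ (funext fun t => ?_)
  rw [fracIntegral, ← intervalIntegral.integral_const_mul]
  congr 1 with s
  rw [ContinuousLinearMap.mul_apply', show -β * t = -β * s + -β * (t - s) by ring, Real.exp_add]
  ring

section LaplaceFracIntegral

variable {β ν : ℝ} (hβ : 0 < β) (hν : 0 < ν) {f : ℝ → ℝ}
  (hf : IntegrableOn (fun s => Real.exp (-β * s) * f s) (Set.Ioi 0))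

include hβ hν hf

lemma integrableOn_exp_mul_fracIntegral :
    IntegrableOn (fun t => Real.exp (-β * t) * fracIntegral ν f t) (Set.Ioi 0) := by
  rw [← integrable_indicator_iff measurableSet_Ioi, ← posConvolution_exp_mul_fracKernel]
  exact integrable_posConvolution hf (integrableOn_exp_mul_fracKernel hβ hν) _

lemma integral_exp_mul_fracIntegral :
    ∫ t in Set.Ioi 0, Real.exp (-β * t) * fracIntegral ν f t
      = (β ^ ν)⁻¹ * ∫ s in Set.Ioi 0, Real.exp (-β * s) * f s := by
  have hconv := integral_posConvolution hf (integrableOn_exp_mul_fracKernel hβ hν)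
    (ContinuousLinearMap.mul ℝ ℝ)
  rw [ContinuousLinearMap.mul_apply', integral_Ioi_exp_mul_fracKernel hβ hν] at hconv
  rw [← integral_indicator measurableSet_Ioi, ← posConvolution_exp_mul_fracKernel, mul_comm,
    ← hconv, ← integral_indicator measurableSet_Ioi]
  rfl

end LaplaceFracIntegral

/-! ### The Yule–Simon distribution -/

lemma yuleSimon_nonneg {a : ℝ} (ha : 0 ≤ a) (n : ℕ) : 0 ≤ yuleSimon a n := by
  have hΓ {x : ℝ} (hx : 0 ≤ x) : 0 ≤ Real.Gamma x := Real.Gamma_nonneg_of_nonneg hx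
  exact mul_nonneg ha (div_nonneg (mul_nonneg (hΓ (by positivity)) (hΓ n.cast_nonneg))
    (hΓ (by positivity)))

lemma yuleSimon_succ {a : ℝ} (ha : 0 < a) (n : ℕ) :
    (a + (n + 1)) * yuleSimon a (n + 1) = (if n = 0 then a else 0) + n * yuleSimon a n := by
  have hden : Real.Gamma (a + (n + 1 : ℕ) + 1) = (a + (n + 1)) * Real.Gamma (a + n + 1) := by
    rw [Real.Gamma_add_one (by positivity), Nat.cast_succ, add_assoc a]
  have hden_ne := (Real.Gamma_pos_of_pos (show 0 < a + n + 1 by positivity)).ne'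
  rw [yuleSimon, hden]
  rcases Nat.eq_zero_or_pos n with rfl | hn
  · simp only [Nat.cast_zero, add_zero, zero_add, Nat.cast_one, Real.Gamma_one] at hden_ne ⊢
    field_simp
    simp
  · have hn' : (n : ℝ) ≠ 0 := (Nat.cast_pos.2 hn).ne'
    rw [if_neg hn.ne', yuleSimon, Nat.cast_succ, Real.Gamma_add_one hn']
    field_simp
    ring

lemma tendsto_natCast_mul_yuleSimon {a : ℝ} (ha : 0 < a) :
    Tendsto (fun n : ℕ => (n : ℝ) * yuleSimon a n) atTop (𝓝 0) := by
  have hprod : ∀ n : ℕ, Real.Gamma (a + n + 1)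
      = Real.Gamma a * ∏ j ∈ Finset.range (n + 1), (a + j) := fun n => by
    induction n with
    | zero => simp [Real.Gamma_add_one ha.ne', mul_comm]
    | succ n ih =>
      rw [Finset.prod_range_succ, ← mul_assoc, ← ih, mul_comm, Real.Gamma_add_one (by positivity)]
      push_cast
      ring_nf
  have hdecay : Tendsto (fun n : ℕ => (n : ℝ) ^ (-a)) atTop (𝓝 0) :=
    (tendsto_rpow_neg_atTop ha).comp tendsto_natCast_atTop_atTop
  have hlim := ((Real.GammaSeq_tendsto_Gamma a).mul hdecay).const_mul (a ^ 2)
  rw [mul_zero, mul_zero] at hlim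
  refine hlim.congr' ?_
  filter_upwards [eventually_gt_atTop 0] with n hn
  have hn' : (0 : ℝ) < n := Nat.cast_pos.2 hn
  have : 0 < ∏ j ∈ Finset.range (n + 1), (a + j) := Finset.prod_pos fun j _ => by positivity
  have hΓ := (Real.Gamma_pos_of_pos ha).ne'
  have hpow := (Real.rpow_pos_of_pos hn' a).ne'
  rw [yuleSimon, hprod, Real.GammaSeq, Real.rpow_neg hn'.le, Real.Gamma_add_one ha.ne',
    ← Real.Gamma_nat_eq_factorial, Real.Gamma_add_one hn'.ne']
  field_simp

lemma hasSum_yuleSimon {a : ℝ} (ha : 0 < a) : HasSum (fun n : ℕ => yuleSimon a (n + 1)) 1 := by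
  rw [hasSum_iff_tendsto_nat_of_nonneg fun n => yuleSimon_nonneg ha.le _]
  have hpartial : ∀ n : ℕ,
      ∑ m ∈ Finset.range n, yuleSimon a (m + 1)
        = (if n = 0 then 0 else 1) - n * yuleSimon a n / a := by
    intro n
    induction n with
    | zero => simp
    | succ n ih =>
      have hrec := yuleSimon_succ ha n
      rw [Finset.sum_range_succ, ih, if_neg n.succ_ne_zero]
      split_ifs at hrec ⊢ <;> push_cast <;> field_simp <;> linear_combination hrec
  have hlim := ((tendsto_natCast_mul_yuleSimon ha).div_const a).const_sub 1
  rw [zero_div, sub_zero] at hlim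
  refine hlim.congr' ?_
  filter_upwards [eventually_ne_atTop 0] with n hn
  rw [hpartial, if_neg hn]

lemma sum_choose_div_eq_yuleSimon {a : ℝ} (ha : 0 < a) (n : ℕ) :
    ∑ j ∈ Finset.range (n + 1), (n.choose j : ℝ) * (-1) ^ j * (a / (a + (j + 1)))
      = yuleSimon a (n + 1) := by
  have hmono : ∀ j : ℕ, ∫ x in (0 : ℝ)..1, x ^ (a + j) = 1 / (a + (j + 1)) := fun j => by
    have hj : -1 < a + (j : ℝ) := neg_one_lt_zero.trans (by positivity)
    rw [integral_rpow (Or.inl hj), Real.one_rpow, Real.zero_rpow (by positivity),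
      sub_zero, add_assoc]
  have hexpand : ∀ x : ℝ, 0 < x → (1 - x) ^ (((n + 1 : ℕ) : ℝ) - 1) * x ^ (a + 1 - 1)
      = ∑ j ∈ Finset.range (n + 1), (n.choose j : ℝ) * (-1) ^ j * x ^ (a + j) := fun x hx => by
    rw [Nat.cast_succ, add_sub_cancel_right, add_sub_cancel_right, Real.rpow_natCast,
      sub_eq_neg_add, add_pow, Finset.sum_mul]
    refine Finset.sum_congr rfl fun j _ => ?_
    rw [one_pow, Real.rpow_add_natCast hx.ne', neg_pow]
    ring
  have hbeta := integral_sub_rpow_mul_rpow (a := (n + 1 : ℕ)) (b := a + 1) (by positivity)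
    (by positivity) one_pos
  rw [intervalIntegral.integral_congr_ae (Eventually.of_forall fun x hx => hexpand x
    (by rw [Set.uIoc_of_le zero_le_one] at hx; exact hx.1)),
    intervalIntegral.integral_finsetSum fun j _ =>
      (intervalIntegral.intervalIntegrable_rpow' (by
        linarith [j.cast_nonneg (α := ℝ)])).const_mul _] at hbeta
  simp only [intervalIntegral.integral_const_mul, hmono, Real.one_rpow, one_mul, beta] at hbeta
  rw [yuleSimon, mul_comm (Real.Gamma (a + 1)), show a + ((n + 1 : ℕ) : ℝ) + 1
    = ((n + 1 : ℕ) : ℝ) + (a + 1) by ring, ← hbeta, Finset.mul_sum]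
  exact Finset.sum_congr rfl fun j _ => by ring

/-! ### Fractional birth processes -/

section BirthProcess

variable {Ω : Type*} [MeasurableSpace Ω] {P : Measure Ω} {ν β lam : ℝ} {rate : ℕ → ℝ}
  {X : ℝ≥0 → Ω → ℕ}

namespace IsFractionalBirthProcess

lemma one_le (hX : IsFractionalBirthProcess P ν rate X) (s : ℝ≥0) (ω : Ω) : 1 ≤ X s ω :=
  hX.initial ω ▸ hX.monotone ω zero_le

lemma stateProb_zero_left (hX : IsFractionalBirthProcess P ν rate X) (t : ℝ) :
    stateProb P X 0 t = 0 := by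
  have hempty : {ω | X t.toNNReal ω = 0} = ∅ :=
    Set.eq_empty_of_forall_notMem fun ω hω =>
      (Nat.one_le_iff_ne_zero.1 (hX.one_le t.toNNReal ω)) hω
  rw [stateProb, hempty, measureReal_empty]

lemma continuous_stateProb (hX : IsFractionalBirthProcess P ν rate X) (n : ℕ) :
    Continuous (stateProb P X n) := by
  rcases Nat.eq_zero_or_pos n with rfl | hn
  · exact continuous_const.congr fun t => (hX.stateProb_zero_left t).symm
  have hIci : ContinuousOn (stateProb P X n) (Set.Ici 0) := fun t ht => by
    have ht' : 0 < t + 1 := add_pos_of_nonneg_of_pos ht one_pos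
    have hcont := (hX.absolutelyContinuous n hn (t + 1) ht').continuousOn
    rw [Set.uIcc_of_le ht'.le] at hcont
    refine (hcont t ⟨ht, by linarith⟩).mono_of_mem_nhdsWithin ?_
    filter_upwards [self_mem_nhdsWithin, mem_nhdsWithin_of_mem_nhds (Iio_mem_nhds (lt_add_one t))]
      with x hx0 hx1 using ⟨hx0, le_of_lt hx1⟩
  have hmax : ∀ t, stateProb P X n (max t 0) = stateProb P X n t := fun t => by
    simp only [stateProb, ← Real.coe_toNNReal', Real.toNNReal_coe]
  exact (hIci.comp_continuous (by fun_prop) fun t => le_max_right t 0).congr hmax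

lemma stateProb_succ [IsProbabilityMeasure P] (hν0 : 0 < ν) (hν1 : ν < 1)
    (hX : IsFractionalBirthProcess P ν rate X) (n : ℕ) {t : ℝ} (ht : 0 < t) :
    stateProb P X (n + 1) t = (if n = 0 then 1 else 0)
      + fracIntegral ν (fun s => -rate (n + 1) * stateProb P X (n + 1) s
          + rate n * stateProb P X n s) t := by
  have hinit : stateProb P X (n + 1) 0 = if n = 0 then 1 else 0 := by
    rcases n with _ | n <;> simp [stateProb, hX.initial]
  have hcaputo := fracIntegral_caputoDeriv hν0 hν1 ht.le
    (hX.absolutelyContinuous (n + 1) n.succ_pos t ht)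
  rw [fracIntegral_congr ν ht.le fun s hs => hX.governing (n + 1) n.succ_pos s hs.1,
    hinit] at hcaputo
  exact (add_eq_of_eq_sub' hcaputo).symm

lemma stateProb_eq_linearBirthProb [IsProbabilityMeasure P] (hν0 : 0 < ν) (hν1 : ν < 1)
    (hX : IsFractionalBirthProcess P ν (fun r => lam * r) X) (n : ℕ) {t : ℝ} (ht : 0 < t) :
    stateProb P X n t = linearBirthProb ν lam n t := by
  induction n generalizing t with
  | zero => simp [hX.stateProb_zero_left, linearBirthProb]
  | succ n ih =>
    have hcont := hX.continuous_stateProb (n + 1)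
    have hcont' := continuous_linearBirthProb hν0 lam (n + 1)
    set D : ℝ → ℝ := fun s => stateProb P X (n + 1) s - linearBirthProb ν lam (n + 1) s
    have hDeq : ∀ s ∈ Set.Ioc 0 t, D s = -(lam * (n + 1)) * fracIntegral ν D s := fun s hs => by
      have hpn := hX.continuous_stateProb n
      have hqn := continuous_linearBirthProb hν0 lam n
      change stateProb P X (n + 1) s - linearBirthProb ν lam (n + 1) s = _
      rw [hX.stateProb_succ hν0 hν1 n hs.1, linearBirthProb_succ hν0 lam n hs.1,
        add_sub_add_left_eq_sub, ← fracIntegral_sub hν0 hs.1.le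
          (Continuous.continuousOn (by fun_prop)) (Continuous.continuousOn (by fun_prop)),
        ← fracIntegral_const_mul]
      refine fracIntegral_congr ν hs.1.le fun u hu => ?_
      rw [ih hu.1]
      push_cast
      ring
    have hDbdd : ∃ M, ∀ s ∈ Set.Ioc 0 t, |D s| ≤ M :=
      (isCompact_Icc.exists_bound_of_continuousOn (hcont.sub hcont').continuousOn).imp
        fun M hM s hs => hM s (Set.Ioc_subset_Icc_self hs)
    exact sub_eq_zero.1 (eq_zero_of_eq_const_mul_fracIntegral hν0 hDeq hDbdd t ⟨ht, le_rfl⟩)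

lemma integral_exp_mul_stateProb [IsProbabilityMeasure P] (hβ : 0 < β) (hν0 : 0 < ν) (hν1 : ν < 1)
    (hX : IsFractionalBirthProcess P ν (fun r => lam * r) X) (n : ℕ) {t : ℝ} (ht : 0 < t) :
    ∫ y in (0 : ℝ)..t, β * Real.exp (-β * y) * stateProb P X n y
      = ∑ j ∈ Finset.range n,
          ((n - 1).choose j : ℝ) * (-1) ^ j * ∑' r, lowerTerm β ν lam t (j + 1) r := by
  calc ∫ y in (0 : ℝ)..t, β * Real.exp (-β * y) * stateProb P X n y
      = ∫ y in (0 : ℝ)..t, ∑ j ∈ Finset.range n, ((n - 1).choose j : ℝ) * (-1) ^ j *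
          (β * Real.exp (-β * y) * mittagLeffler ν (-(lam * (j + 1 : ℕ)) * y ^ ν)) := by
        refine intervalIntegral.integral_congr_ae (Eventually.of_forall fun y hy => ?_)
        rw [Set.uIoc_of_le ht.le] at hy
        rw [hX.stateProb_eq_linearBirthProb hν0 hν1 n hy.1, linearBirthProb, Finset.mul_sum]
        refine Finset.sum_congr rfl fun j _ => ?_
        push_cast
        ring
    _ = _ := by
        rw [intervalIntegral.integral_finsetSum fun j _ => by
          have := continuous_mittagLeffler_const_mul_rpow hν0 (-(lam * (j + 1 : ℕ)))
          exact Continuous.intervalIntegrable (by fun_prop) _ _]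
        refine Finset.sum_congr rfl fun j _ => ?_
        rw [intervalIntegral.integral_const_mul, (hasSum_lowerTerm hβ hν0 ht (j + 1)).tsum_eq]

lemma integrableOn_exp_mul_stateProb [IsProbabilityMeasure P] (hβ : 0 < β)
    (hX : IsFractionalBirthProcess P ν rate X) (n : ℕ) (a : ℝ) :
    IntegrableOn (fun y => Real.exp (-β * y) * stateProb P X n y) (Set.Ioi a) :=
  (integrableOn_exp_mul_Ioi (neg_neg_of_pos hβ) a).mul_bdd (c := 1)
    (hX.continuous_stateProb n).aestronglyMeasurable
    (Eventually.of_forall fun y => by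
      rw [stateProb, Real.norm_of_nonneg measureReal_nonneg]
      exact measureReal_le_one)

lemma laplace_stateProb_succ [IsProbabilityMeasure P] (hβ : 0 < β) (hν0 : 0 < ν) (hν1 : ν < 1)
    (hX : IsFractionalBirthProcess P ν rate X) (n : ℕ) :
    (β ^ ν + rate (n + 1)) * ∫ y in Set.Ioi 0, Real.exp (-β * y) * stateProb P X (n + 1) y
      = (if n = 0 then 1 else 0) * (β ^ ν / β)
        + rate n * ∫ y in Set.Ioi 0, Real.exp (-β * y) * stateProb P X n y := by
  have hsucc := (hX.integrableOn_exp_mul_stateProb hβ (n + 1) 0).const_mul (-rate (n + 1))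
  have hn := (hX.integrableOn_exp_mul_stateProb hβ n 0).const_mul (rate n)
  have hsplit : ∀ y, Real.exp (-β * y) * (-rate (n + 1) * stateProb P X (n + 1) y
      + rate n * stateProb P X n y) = -rate (n + 1) * (Real.exp (-β * y) * stateProb P X (n + 1) y)
        + rate n * (Real.exp (-β * y) * stateProb P X n y) := fun y => by ring
  have hint : IntegrableOn (fun y => Real.exp (-β * y) * (-rate (n + 1) * stateProb P X (n + 1) y
      + rate n * stateProb P X n y)) (Set.Ioi 0) :=
    (hsucc.add hn).congr (Eventually.of_forall fun y => (hsplit y).symm)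
  have htransform : ∫ y in Set.Ioi 0, Real.exp (-β * y) * stateProb P X (n + 1) y
      = (if n = 0 then 1 else 0) / β + (β ^ ν)⁻¹ *
        (-rate (n + 1) * (∫ y in Set.Ioi 0, Real.exp (-β * y) * stateProb P X (n + 1) y)
          + rate n * ∫ y in Set.Ioi 0, Real.exp (-β * y) * stateProb P X n y) := by
    calc _ = ∫ y in Set.Ioi 0, (Real.exp (-β * y) * (if n = 0 then 1 else 0)
          + Real.exp (-β * y) * fracIntegral ν (fun s => -rate (n + 1) * stateProb P X (n + 1) s
              + rate n * stateProb P X n s) y) :=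
          setIntegral_congr_fun measurableSet_Ioi fun y hy => by
            simp only [← mul_add, ← hX.stateProb_succ hν0 hν1 n hy]
      _ = _ := by
          rw [integral_add ((integrableOn_exp_mul_Ioi (neg_neg_of_pos hβ) 0).mul_const _)
            (integrableOn_exp_mul_fracIntegral hβ hν0 hint),
            integral_exp_mul_fracIntegral hβ hν0 hint, integral_mul_const,
            integral_exp_mul_Ioi (neg_neg_of_pos hβ)]
          simp only [hsplit]
          rw [integral_add hsucc hn, integral_const_mul, integral_const_mul, mul_zero,
            Real.exp_zero, neg_div_neg_eq, one_div_mul_eq_div]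
  have hcleared := congrArg (β ^ ν * ·) htransform
  simp only [mul_add (β ^ ν), mul_inv_cancel_left₀ (Real.rpow_pos_of_pos hβ ν).ne'] at hcleared
  linear_combination hcleared

lemma laplace_stateProb_eq_yuleSimon [IsProbabilityMeasure P] (hβ : 0 < β) (hν0 : 0 < ν)
    (hν1 : ν < 1) (hlam : 0 < lam) (hX : IsFractionalBirthProcess P ν (fun r => lam * r) X)
    {n : ℕ} (hn : 1 ≤ n) :
    ∫ y in Set.Ioi 0, Real.exp (-β * y) * stateProb P X n y = yuleSimon (β ^ ν / lam) n / β := by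
  have hβν := Real.rpow_pos_of_pos hβ ν
  induction n, hn using Nat.le_induction with
  | base =>
    have hlaplace := hX.laplace_stateProb_succ hβ hν0 hν1 0
    have hsimon := yuleSimon_succ (div_pos hβν hlam) 0
    simp only [Nat.cast_zero, mul_zero, zero_mul, add_zero, zero_add, Nat.cast_one, mul_one,
      one_mul, if_true] at hlaplace hsimon
    have hne : β ^ ν + lam ≠ 0 := by positivity
    refine mul_left_cancel₀ hne ?_
    rw [hlaplace]
    field_simp at hsimon ⊢
    linear_combination -hsimon
  | succ n hn ih =>
    have hlaplace := hX.laplace_stateProb_succ hβ hν0 hν1 n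
    have hsimon := yuleSimon_succ (div_pos hβν hlam) n
    rw [if_neg (Nat.one_le_iff_ne_zero.1 hn)] at hlaplace hsimon
    rw [zero_mul, zero_add] at hlaplace
    have hne : β ^ ν + lam * (n + 1 : ℕ) ≠ 0 := by positivity
    refine mul_left_cancel₀ hne ?_
    rw [hlaplace, ih]
    push_cast
    field_simp at hsimon ⊢
    linear_combination -hsimon

end IsFractionalBirthProcess

end BirthProcess

/-! ### Adding an independent exponential time -/

section ExponentialTime

lemma expMeasure_Ioi {r : ℝ} (hr : 0 < r) {x : ℝ} (hx : 0 ≤ x) :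
    expMeasure r (Set.Ioi x) = ENNReal.ofReal (Real.exp (-(r * x))) := by
  have := isProbabilityMeasure_expMeasure hr
  have hcdf := cdf_expMeasure_eq hr x
  rw [if_pos hx, cdf_eq_real] at hcdf
  rw [← ofReal_measureReal, ← Set.compl_Iic, probReal_compl_eq_one_sub measurableSet_Iic, hcdf,
    sub_sub_cancel]

lemma expMeasure_Iio_zero {r : ℝ} (hr : 0 < r) : expMeasure r (Set.Iio 0) = 0 := by
  have := isProbabilityMeasure_expMeasure hr
  have hcdf := cdf_expMeasure_eq hr 0
  rw [if_pos le_rfl, cdf_eq_real, mul_zero, neg_zero, Real.exp_zero, sub_self,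
    measureReal_eq_zero_iff] at hcdf
  exact measure_mono_null Set.Iio_subset_Iic_self hcdf

lemma lintegral_const_add_expMeasure (r a : ℝ) {f : ℝ → ℝ≥0∞} (hf : Measurable f) :
    ∫⁻ s, f (a + s) ∂(expMeasure r)
      = ∫⁻ u, (Set.Ici a).indicator
          (fun u => ENNReal.ofReal (r * Real.exp (-(r * (u - a)))) * f u) u := by
  have hdensity : expMeasure r = volume.withDensity (exponentialPDF r) := rfl
  rw [hdensity, lintegral_withDensity_eq_lintegral_mul _
    (show Measurable (exponentialPDF r) from (measurable_exponentialPDFReal r).ennreal_ofReal)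
    (show Measurable fun s => f (a + s) by fun_prop), ← lintegral_sub_right_eq_self _ a]
  refine lintegral_congr fun u => ?_
  by_cases hu : a ≤ u <;> simp [exponentialPDF_eq, hu]

variable {Ω : Type*} [MeasurableSpace Ω] {P : Measure Ω}

lemma lintegral_apply_of_indepFun [IsFiniteMeasure P] {α γ : Type*} [MeasurableSpace α]
    [MeasurableSpace γ] {U : Ω → α} {V : Ω → γ} (hU : Measurable U) (hV : Measurable V)
    (hind : IndepFun U V P) {F : α → γ → ℝ≥0∞} (hF : Measurable (Function.uncurry F)) :
    ∫⁻ ω, F (U ω) (V ω) ∂P = ∫⁻ ω, ∫⁻ v, F (U ω) v ∂(P.map V) ∂P := by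
  calc ∫⁻ ω, F (U ω) (V ω) ∂P
      = ∫⁻ z, Function.uncurry F z ∂(P.map fun ω => (U ω, V ω)) :=
        (lintegral_map hF (hU.prodMk hV)).symm
    _ = ∫⁻ u, ∫⁻ v, F u v ∂(P.map V) ∂(P.map U) := by
        rw [(indepFun_iff_map_prod_eq_prod_map_map hU.aemeasurable hV.aemeasurable).1 hind,
          lintegral_prod _ hF.aemeasurable]
        rfl
    _ = ∫⁻ ω, ∫⁻ v, F (U ω) v ∂(P.map V) ∂P := lintegral_map hF.lintegral_prod_right' hU

/-- The expectation of `exp (-r (t - T)) Z` on the event `T ≤ t`. When a clock `S`, exponential of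
rate `r` and independent of `(T, Z)`, is started at time `T`, this is the expectation of `Z` on the
event that the clock is running at time `t`. -/
noncomputable def runningMass (P : Measure Ω) (r : ℝ) (T : Ω → ℝ) (Z : Ω → ℝ≥0∞) (t : ℝ) :
    ℝ≥0∞ :=
  ∫⁻ ω, {ω | T ω ≤ t}.indicator (fun ω => ENNReal.ofReal (Real.exp (-(r * (t - T ω)))) * Z ω) ω ∂P

lemma runningMass_const_mul {r : ℝ} {T : Ω → ℝ} (hT : Measurable T) {Z : Ω → ℝ≥0∞}
    (hZ : Measurable Z) (c : ℝ≥0∞) (t : ℝ) :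
    runningMass P r T (fun ω => c * Z ω) t = c * runningMass P r T Z t := by
  rw [runningMass, runningMass, ← lintegral_const_mul _
    (Measurable.indicator (by fun_prop) (measurableSet_le hT measurable_const))]
  refine lintegral_congr fun ω => ?_
  by_cases hω : T ω ≤ t <;> simp [hω, mul_left_comm]

lemma runningMass_add {r : ℝ} {T : Ω → ℝ} (hT : Measurable T) {Z W : Ω → ℝ≥0∞}
    (hZ : Measurable Z) (t : ℝ) :
    runningMass P r T (fun ω => Z ω + W ω) t = runningMass P r T Z t + runningMass P r T W t := by
  rw [runningMass, runningMass, runningMass, ← lintegral_add_left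
    (Measurable.indicator (by fun_prop) (measurableSet_le hT measurable_const))]
  refine lintegral_congr fun ω => ?_
  by_cases hω : T ω ≤ t <;> simp [hω, mul_add]

variable [IsProbabilityMeasure P] {T S : Ω → ℝ} {Z : Ω → ℝ≥0∞} {r : ℝ}

lemma lintegral_indicator_lt_add (hr : 0 < r) (hT : Measurable T) (hZ : Measurable Z)
    (hS : Measurable S) (hind : IndepFun (fun ω => (T ω, Z ω)) S P)
    (hlaw : P.map S = expMeasure r) (t : ℝ) :
    ∫⁻ ω, {ω | T ω ≤ t ∧ t < T ω + S ω}.indicator Z ω ∂P = runningMass P r T Z t := by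
  set F : ℝ × ℝ≥0∞ → ℝ → ℝ≥0∞ := fun z s =>
    {q : (ℝ × ℝ≥0∞) × ℝ | q.1.1 ≤ t ∧ t < q.1.1 + q.2}.indicator (fun q => q.1.2) (z, s) with hFdef
  have hF : Measurable (Function.uncurry F) :=
    Measurable.indicator (by fun_prop)
      ((measurableSet_le (f := fun q : (ℝ × ℝ≥0∞) × ℝ => q.1.1) (by fun_prop)
        measurable_const).inter (measurableSet_lt (g := fun q : (ℝ × ℝ≥0∞) × ℝ => q.1.1 + q.2)
        measurable_const (by fun_prop)))
  refine (lintegral_apply_of_indepFun (hT.prodMk hZ) hS hind hF).trans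
    (lintegral_congr fun ω => ?_)
  rw [hlaw]
  by_cases hω : T ω ≤ t
  · rw [Set.indicator_of_mem (by exact hω), ← expMeasure_Ioi hr (sub_nonneg.2 hω), mul_comm,
      ← lintegral_indicator_const measurableSet_Ioi]
    refine lintegral_congr fun s => ?_
    simp only [hFdef, Set.indicator, Set.mem_ofPred_eq, hω, true_and, Set.mem_Ioi,
      sub_lt_iff_lt_add']
  · simp [hFdef, Set.indicator, hω]

lemma lintegral_apply_add (hr : 0 < r) (hT : Measurable T) (hZ : Measurable Z)
    (hS : Measurable S) (hind : IndepFun (fun ω => (T ω, Z ω)) S P)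
    (hlaw : P.map S = expMeasure r) {F : ℝ≥0∞ → ℝ → ℝ≥0∞}
    (hF : Measurable (Function.uncurry F)) :
    ∫⁻ ω, F (Z ω) (T ω + S ω) ∂P
      = ∫⁻ u, ENNReal.ofReal r * runningMass P r T (fun ω => F (Z ω) u) u := by
  set K : Ω → ℝ → ℝ≥0∞ := fun ω u => (Set.Ici (T ω)).indicator
    (fun u => ENNReal.ofReal (r * Real.exp (-(r * (u - T ω)))) * F (Z ω) u) u with hKdef
  have : Measurable fun z : Ω × ℝ => F (Z z.1) z.2 :=
    hF.comp (g := Function.uncurry F) (by fun_prop : Measurable fun z : Ω × ℝ => (Z z.1, z.2))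
  have hK : Measurable (Function.uncurry K) :=
    Measurable.indicator
      (f := fun z : Ω × ℝ => ENNReal.ofReal (r * Real.exp (-(r * (z.2 - T z.1)))) * F (Z z.1) z.2)
      (by fun_prop) (measurableSet_le (by fun_prop : Measurable fun z : Ω × ℝ => T z.1)
        measurable_snd)
  have hFadd : Measurable (Function.uncurry fun (z : ℝ × ℝ≥0∞) s => F z.2 (z.1 + s)) :=
    hF.comp (g := Function.uncurry F)
      (by fun_prop : Measurable fun q : (ℝ × ℝ≥0∞) × ℝ => (q.1.2, q.1.1 + q.2))
  calc ∫⁻ ω, F (Z ω) (T ω + S ω) ∂P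
      = ∫⁻ ω, ∫⁻ s, F (Z ω) (T ω + s) ∂(expMeasure r) ∂P := by
        rw [← hlaw]
        exact lintegral_apply_of_indepFun (hT.prodMk hZ) hS hind hFadd
    _ = ∫⁻ ω, (∫⁻ u, K ω u) ∂P :=
        lintegral_congr fun ω => lintegral_const_add_expMeasure r (T ω) hF.of_uncurry_left
    _ = ∫⁻ u, ∫⁻ ω, K ω u ∂P := lintegral_lintegral_swap hK.aemeasurable
    _ = ∫⁻ u, ENNReal.ofReal r * runningMass P r T (fun ω => F (Z ω) u) u := by
        refine lintegral_congr fun u => ?_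
        rw [runningMass, ← lintegral_const_mul' _ _ ENNReal.ofReal_ne_top]
        refine lintegral_congr fun ω => ?_
        by_cases hω : T ω ≤ u <;> simp [hKdef, hω, ENNReal.ofReal_mul hr.le, mul_assoc]

lemma runningMass_add_exponential (hr : 0 < r) (r' : ℝ) (hT : Measurable T) (hZ : Measurable Z)
    (hS : Measurable S) (hind : IndepFun (fun ω => (T ω, Z ω)) S P)
    (hlaw : P.map S = expMeasure r) {h : ℝ → ℝ≥0∞} (hh : Measurable h) (t : ℝ) :
    runningMass P r' (fun ω => T ω + S ω) (fun ω => Z ω + h (T ω + S ω)) t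
      = ∫⁻ u in Set.Iic t, ENNReal.ofReal (Real.exp (-(r' * (t - u)))) *
          (ENNReal.ofReal r * (runningMass P r T Z u + h u * runningMass P r T 1 u)) := by
  set F : ℝ≥0∞ → ℝ → ℝ≥0∞ := fun z =>
    (Set.Iic t).indicator fun u => ENNReal.ofReal (Real.exp (-(r' * (t - u)))) * (z + h u)
    with hFdef
  have hF : Measurable (Function.uncurry F) :=
    Measurable.indicator (f := fun q : ℝ≥0∞ × ℝ =>
      ENNReal.ofReal (Real.exp (-(r' * (t - q.2)))) * (q.1 + h q.2)) (by fun_prop)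
      (measurableSet_le measurable_snd measurable_const)
  have hrun (u : ℝ) : runningMass P r T (fun ω => Z ω + h u) u
      = runningMass P r T Z u + h u * runningMass P r T 1 u := by
    rw [runningMass_add hT hZ, ← runningMass_const_mul hT measurable_one]
    simp only [Pi.one_apply, mul_one]
  refine (lintegral_apply_add hr hT hZ hS hind hlaw hF).trans ?_
  rw [← lintegral_indicator measurableSet_Iic]
  refine lintegral_congr fun u => ?_
  by_cases hu : u ≤ t
  · simp only [hFdef, Set.mem_Iic, hu, Set.indicator_of_mem]
    rw [runningMass_const_mul hT (by fun_prop), hrun, mul_left_comm]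
  · simp [hFdef, hu, runningMass]

end ExponentialTime

/-! ### The Yule process -/

section YuleFunctions

lemma setLIntegral_Iic_exp_mul_indicator {c t : ℝ} {f G : ℝ → ℝ} (hf : Continuous f)
    (hf0 : ∀ u, 0 ≤ u → 0 ≤ f u) (hG0 : G 0 = 0)
    (hG : ∀ u, HasDerivAt G (f u - c * G u) u) :
    ∫⁻ u in Set.Iic t, ENNReal.ofReal (Real.exp (-(c * (t - u)))) *
        (Set.Ici 0).indicator (fun u => ENNReal.ofReal (f u)) u
      = (Set.Ici 0).indicator (fun t => ENNReal.ofReal (G t)) t := by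
  have hleft : ∫⁻ u in Set.Iic t, ENNReal.ofReal (Real.exp (-(c * (t - u)))) *
        (Set.Ici 0).indicator (fun u => ENNReal.ofReal (f u)) u
      = ∫⁻ u in Set.Icc 0 t, ENNReal.ofReal (Real.exp (-(c * (t - u))) * f u) := by
    rw [← Set.Ici_inter_Iic, ← setLIntegral_indicator measurableSet_Ici]
    refine lintegral_congr fun u => ?_
    by_cases hu : 0 ≤ u <;> simp [hu, ENNReal.ofReal_mul, Real.exp_nonneg]
  rw [hleft]
  rcases lt_or_ge t 0 with ht | ht
  · simp [ht.not_ge]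
  have hderiv (u : ℝ) : HasDerivAt (fun u => Real.exp (-(c * (t - u))) * G u)
      (Real.exp (-(c * (t - u))) * f u) u := by
    have hexp : HasDerivAt (fun u => Real.exp (-(c * (t - u))))
        (Real.exp (-(c * (t - u))) * c) u := by
      convert! (((hasDerivAt_id u).const_sub t).const_mul c).neg.exp using 1
      simp
    convert! hexp.mul (hG u) using 1
    ring
  have hcont : Continuous fun u => Real.exp (-(c * (t - u))) * f u := by fun_prop
  rw [Set.indicator_of_mem (Set.mem_Ici.2 ht), setLIntegral_congr Ioc_ae_eq_Icc.symm,
    ← ofReal_integral_eq_lintegral_ofReal hcont.integrableOn_Ioc, ←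
    intervalIntegral.integral_of_le ht, intervalIntegral.integral_eq_sub_of_hasDerivAt
      (fun u _ => hderiv u) (hcont.intervalIntegrable _ _)]
  · simp [hG0]
  · filter_upwards [ae_restrict_mem measurableSet_Ioc] with u hu
    exact mul_nonneg (Real.exp_nonneg _) (hf0 u hu.1.le)

/-- The probability that a Yule process of rate `β`, started from one individual, has `m + 1`
individuals at time `t`. -/
noncomputable def yuleProb (β : ℝ) (m : ℕ) (t : ℝ) : ℝ :=
  Real.exp (-(β * t)) * (1 - Real.exp (-(β * t))) ^ m

/-- The factor of `ageIntegral β h t` in the expectation of `jumpSum S h m` on the event that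
a Yule process of rate `β` has `m + 1` individuals at time `t`. -/
noncomputable def yuleWeight (β : ℝ) (m : ℕ) (t : ℝ) : ℝ :=
  m * (1 - Real.exp (-(β * t))) ^ (m - 1) * Real.exp (-(β * t)) ^ 2

/-- The integral of `h` against the intensity `β exp (β s)` of the births in a Yule process of
rate `β`. -/
noncomputable def ageIntegral (β : ℝ) (h : ℝ → ℝ) (t : ℝ) : ℝ :=
  ∫ s in (0 : ℝ)..t, β * Real.exp (β * s) * h s

variable {β t : ℝ} {h : ℝ → ℝ}

lemma one_sub_exp_neg_mul_nonneg (hβ : 0 < β) (ht : 0 ≤ t) : 0 ≤ 1 - Real.exp (-(β * t)) :=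
  sub_nonneg.2 (Real.exp_le_one_iff.2 (neg_nonpos.2 (by positivity)))

lemma yuleProb_nonneg (hβ : 0 < β) (m : ℕ) (ht : 0 ≤ t) : 0 ≤ yuleProb β m t :=
  mul_nonneg (Real.exp_nonneg _) (pow_nonneg (one_sub_exp_neg_mul_nonneg hβ ht) _)

lemma yuleWeight_nonneg (hβ : 0 < β) (m : ℕ) (ht : 0 ≤ t) : 0 ≤ yuleWeight β m t := by
  have := pow_nonneg (one_sub_exp_neg_mul_nonneg hβ ht) (m - 1)
  unfold yuleWeight
  positivity

lemma ageIntegral_nonneg (hβ : 0 < β) (h0 : ∀ s, 0 ≤ h s) (ht : 0 ≤ t) :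
    0 ≤ ageIntegral β h t :=
  intervalIntegral.integral_nonneg ht fun s _ => mul_nonneg (by positivity) (h0 s)

lemma hasSum_yuleProb (hβ : 0 < β) (ht : 0 ≤ t) : HasSum (fun m => yuleProb β m t) 1 := by
  have hx := Real.exp_pos (-(β * t))
  have hgeom := (hasSum_geometric_of_lt_one (one_sub_exp_neg_mul_nonneg hβ ht)
    (sub_lt_self 1 hx)).mul_left (Real.exp (-(β * t)))
  rwa [sub_sub_cancel, mul_inv_cancel₀ hx.ne'] at hgeom

lemma hasDerivAt_exp_neg_mul (β u : ℝ) :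
    HasDerivAt (fun u => Real.exp (-(β * u))) (-β * Real.exp (-(β * u))) u := by
  convert! ((hasDerivAt_id u).const_mul β).neg.exp using 1
  simp [mul_comm]

lemma hasDerivAt_ageIntegral (β : ℝ) (hh : Continuous h) (t : ℝ) :
    HasDerivAt (ageIntegral β h) (β * Real.exp (β * t) * h t) t := by
  have hc : Continuous fun s => β * Real.exp (β * s) * h s := by fun_prop
  exact intervalIntegral.integral_hasDerivAt_right (hc.intervalIntegrable _ _)
    hc.stronglyMeasurable.stronglyMeasurableAtFilter hc.continuousAt

lemma continuous_ageIntegral (β : ℝ) (hh : Continuous h) : Continuous (ageIntegral β h) :=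
  continuous_iff_continuousAt.2 fun t => (hasDerivAt_ageIntegral β hh t).continuousAt

lemma hasDerivAt_yuleProb_succ (β : ℝ) (m : ℕ) (u : ℝ) :
    HasDerivAt (yuleProb β (m + 1))
      (β * (m + 1) * yuleProb β m u - β * ((m + 1 : ℕ) + 1) * yuleProb β (m + 1) u) u := by
  have hexp := hasDerivAt_exp_neg_mul β u
  convert! hexp.mul ((hexp.const_sub 1).pow (m + 1)) using 1
  simp only [yuleProb, Pi.pow_apply, Nat.add_sub_cancel]
  push_cast
  ring

lemma hasDerivAt_yuleWeight_succ (β : ℝ) (m : ℕ) (u : ℝ) :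
    HasDerivAt (yuleWeight β (m + 1))
      (β * (m + 1) * yuleWeight β m u - β * ((m + 1 : ℕ) + 1) * yuleWeight β (m + 1) u) u := by
  have hexp := hasDerivAt_exp_neg_mul β u
  convert! (((hexp.const_sub 1).pow m).const_mul ((m + 1 : ℕ) : ℝ)).mul (hexp.pow 2) using 1
  simp only [yuleWeight, Pi.pow_apply]
  rcases m with _ | m
  · simp
    ring
  · push_cast
    ring_nf

lemma yuleWeight_succ_mul_exp (β : ℝ) (m : ℕ) (u : ℝ) :
    yuleWeight β (m + 1) u * Real.exp (β * u) = (m + 1) * yuleProb β m u := by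
  have hexp : Real.exp (-(β * u)) * Real.exp (β * u) = 1 := by
    rw [← Real.exp_add, neg_add_cancel, Real.exp_zero]
  simp only [yuleWeight, yuleProb, Nat.add_sub_cancel, Nat.cast_add, Nat.cast_one]
  linear_combination
    (m + 1) * (1 - Real.exp (-(β * u))) ^ m * Real.exp (-(β * u)) * hexp

lemma hasDerivAt_yuleWeight_succ_mul_ageIntegral (β : ℝ) (hh : Continuous h) (m : ℕ) (u : ℝ) :
    HasDerivAt (fun u => yuleWeight β (m + 1) u * ageIntegral β h u)
      (β * (m + 1) * (yuleWeight β m u * ageIntegral β h u + h u * yuleProb β m u)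
        - β * ((m + 1 : ℕ) + 1) * (yuleWeight β (m + 1) u * ageIntegral β h u)) u := by
  convert! (hasDerivAt_yuleWeight_succ β m u).mul (hasDerivAt_ageIntegral β hh u) using 1
  linear_combination (-(β * h u)) * yuleWeight_succ_mul_exp β m u

end YuleFunctions

section YuleProcess

variable {Ω : Type*}

lemma creationTime_succ (S : ℕ → Ω → ℝ) (m : ℕ) (ω : Ω) :
    creationTime S (m + 1) ω = creationTime S m ω + S m ω :=
  Finset.sum_range_succ _ _

/-- The sum of `h` over the creation times of the webpages `1, …, m`. -/
noncomputable def jumpSum (S : ℕ → Ω → ℝ) (h : ℝ → ℝ) (m : ℕ) (ω : Ω) : ℝ≥0∞ :=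
  ∑ k ∈ Finset.range m, ENNReal.ofReal (h (creationTime S (k + 1) ω))

lemma jumpSum_succ (S : ℕ → Ω → ℝ) (h : ℝ → ℝ) (m : ℕ) (ω : Ω) :
    jumpSum S h (m + 1) ω
      = jumpSum S h m ω + ENNReal.ofReal (h (creationTime S (m + 1) ω)) :=
  Finset.sum_range_succ _ _

/-- The event that exactly the webpages `0, …, m` are present at time `t`. -/
def popEvent (S : ℕ → Ω → ℝ) (t : ℝ) (m : ℕ) : Set Ω := {ω | ∀ k, creationTime S k ω ≤ t ↔ k ≤ m}

lemma numPages_of_mem_popEvent {S : ℕ → Ω → ℝ} {t : ℝ} {m : ℕ} {ω : Ω}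
    (hω : ω ∈ popEvent S t m) : numPages S t ω = m + 1 := by
  have hpresent : {k : ℕ | creationTime S k ω ≤ t} = (Finset.range (m + 1) : Set ℕ) := by
    ext k
    simpa [Nat.lt_succ_iff] using hω k
  rw [numPages, hpresent, Set.ncard_coe_finset, Finset.card_range]

lemma pairwise_disjoint_popEvent (S : ℕ → Ω → ℝ) (t : ℝ) :
    Pairwise (Function.onFun Disjoint (popEvent S t)) := fun m m' hne =>
  Set.disjoint_left.2 fun _ h h' =>
    hne (le_antisymm ((h' m).1 ((h m).2 le_rfl)) ((h m').1 ((h' m').2 le_rfl)))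

lemma measurable_creationTime {_ : MeasurableSpace Ω} {S : ℕ → Ω → ℝ} {m : ℕ}
    (hS : ∀ k < m, Measurable (S k)) : Measurable (creationTime S m) :=
  Finset.measurable_fun_sum _ fun k hk => hS k (Finset.mem_range.1 hk)

lemma measurable_jumpSum {_ : MeasurableSpace Ω} {S : ℕ → Ω → ℝ} {m : ℕ}
    (hS : ∀ k < m, Measurable (S k)) {h : ℝ → ℝ} (hh : Measurable h) :
    Measurable (jumpSum S h m) :=
  Finset.measurable_fun_sum _ fun k hk => (hh.comp (measurable_creationTime fun i hi =>
    hS i (by have := Finset.mem_range.1 hk; omega))).ennreal_ofReal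

lemma measurableSet_popEvent [MeasurableSpace Ω] {S : ℕ → Ω → ℝ} (hS : ∀ k, Measurable (S k))
    (t : ℝ) (m : ℕ) : MeasurableSet (popEvent S t m) := by
  have hpresent (k : ℕ) : MeasurableSet {ω | creationTime S k ω ≤ t} :=
    measurableSet_le (measurable_creationTime fun i _ => hS i) measurable_const
  rw [popEvent, Set.ofPred_forall]
  refine MeasurableSet.iInter fun k => ?_
  by_cases hk : k ≤ m
  · simpa [hk] using hpresent k
  · simpa [hk, Set.compl_def] using (hpresent k).compl

variable [MeasurableSpace Ω] {P : Measure Ω} {β t : ℝ} {S : ℕ → Ω → ℝ} {h : ℝ → ℝ}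

/-- The holding times of a Yule process of rate `β` started from one individual: the part of
`IsGeneralizedYuleModel` that concerns the creation of the webpages. -/
structure IsYuleHolding (P : Measure Ω) (β : ℝ) (S : ℕ → Ω → ℝ) : Prop where
  measurable : ∀ k, Measurable (S k)
  law : ∀ k : ℕ, P.map (S k) = expMeasure (β * (k + 1))
  indep : iIndepFun S P

namespace IsYuleHolding

lemma measurable_creationTime (hS : IsYuleHolding P β S) (m : ℕ) :
    Measurable (creationTime S m) :=
  FractionalYule.measurable_creationTime fun k _ => hS.measurable k

lemma measurable_jumpSum (hS : IsYuleHolding P β S) (hh : Measurable h) (m : ℕ) :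
    Measurable (jumpSum S h m) :=
  FractionalYule.measurable_jumpSum (fun k _ => hS.measurable k) hh

lemma indepFun_of_measurable_past (hS : IsYuleHolding P β S) {γ : Type*} [MeasurableSpace γ]
    {m : ℕ} {U : Ω → γ}
    (hU : Measurable[⨆ k ∈ Set.Iio m, MeasurableSpace.comap (S k) inferInstance] U) :
    IndepFun U (S m) P := by
  have hindep := indep_iSup_of_disjoint (fun k => (hS.measurable k).comap_le) hS.indep
    (S := Set.Iio m) (T := {m}) (by simp)
  rw [iSup_singleton] at hindep
  exact indep_of_indep_of_le_left hindep hU.comap_le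

lemma indepFun_creationTime (hS : IsYuleHolding P β S) (hh : Measurable h) (m : ℕ) :
    IndepFun (fun ω => (creationTime S m ω, jumpSum S h m ω)) (S m) P := by
  refine hS.indepFun_of_measurable_past ?_
  have hpast (k : ℕ) (hk : k < m) :
      Measurable[⨆ k ∈ Set.Iio m, MeasurableSpace.comap (S k) inferInstance] (S k) :=
    (comap_measurable (S k)).mono
      (le_iSup₂ (f := fun k (_ : k ∈ Set.Iio m) => MeasurableSpace.comap (S k) inferInstance) k hk)
      le_rfl
  exact (FractionalYule.measurable_creationTime hpast).prodMk
    (FractionalYule.measurable_jumpSum hpast hh)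

lemma indepFun_creationTime_one (hS : IsYuleHolding P β S) (m : ℕ) :
    IndepFun (fun ω => (creationTime S m ω, (1 : Ω → ℝ≥0∞) ω)) (S m) P :=
  (hS.indepFun_creationTime (h := 0) measurable_zero m).comp (φ := fun z => (z.1, (1 : ℝ≥0∞)))
    (ψ := id) (by fun_prop) measurable_id

lemma ae_nonneg (hS : IsYuleHolding P β S) (hβ : 0 < β) : ∀ᵐ ω ∂P, ∀ k, 0 ≤ S k ω := by
  refine ae_all_iff.2 fun k => ?_
  have hneg := expMeasure_Iio_zero (show 0 < β * (k + 1) by positivity)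
  rw [← hS.law k, Measure.map_apply (hS.measurable k) measurableSet_Iio] at hneg
  rw [ae_iff]
  simpa only [Set.preimage, Set.mem_Iio, not_le] using hneg

lemma popEvent_ae_eq (hS : IsYuleHolding P β S) (hβ : 0 < β) (t : ℝ) (m : ℕ) :
    popEvent S t m =ᵐ[P] {ω | creationTime S m ω ≤ t ∧ t < creationTime S m ω + S m ω} := by
  filter_upwards [hS.ae_nonneg hβ] with ω hω
  have hmono : Monotone fun k => creationTime S k ω :=
    monotone_nat_of_le_succ fun k => by
      rw [creationTime_succ]
      exact le_add_of_nonneg_right (hω k)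
  refine propext ⟨fun hpop => ⟨(hpop m).2 le_rfl, ?_⟩, fun hlast k => ⟨fun hk => ?_, fun hk => ?_⟩⟩
  · rw [← creationTime_succ]
    exact lt_of_not_ge fun hle => (Nat.lt_succ_self m).not_ge ((hpop (m + 1)).1 hle)
  · by_contra! hmk
    have hle : creationTime S m ω + S m ω ≤ creationTime S k ω :=
      (creationTime_succ S m ω).symm.trans_le (hmono hmk)
    exact (hlast.2.trans_le hle).not_ge hk
  · exact (hmono hk).trans hlast.1

variable [IsProbabilityMeasure P]

lemma runningMass_one (hS : IsYuleHolding P β S) (hβ : 0 < β) (m : ℕ) :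
    runningMass P (β * (m + 1)) (creationTime S m) 1
      = (Set.Ici 0).indicator fun t => ENNReal.ofReal (yuleProb β m t) := by
  induction m with
  | zero =>
    ext t
    by_cases ht : 0 ≤ t <;> simp [runningMass, creationTime, yuleProb, ht]
  | succ m ih =>
    ext t
    have hrec := runningMass_add_exponential (h := 0) (by positivity) (β * ((m + 1 : ℕ) + 1))
      (hS.measurable_creationTime m) measurable_one (hS.measurable m)
      (hS.indepFun_creationTime_one m) (hS.law m) measurable_zero t
    simp only [Pi.zero_apply, add_zero, zero_mul, ← creationTime_succ, ih] at hrec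
    refine hrec.trans (Eq.trans ?_ (setLIntegral_Iic_exp_mul_indicator
      (f := fun u => β * (m + 1) * yuleProb β m u) (by unfold yuleProb; fun_prop)
      (fun u hu => mul_nonneg (by positivity) (yuleProb_nonneg hβ m hu)) (by simp [yuleProb])
      (hasDerivAt_yuleProb_succ β m)))
    congr! 3 with u
    by_cases hu : 0 ≤ u <;> simp [hu, ENNReal.ofReal_mul (show 0 ≤ β * (m + 1) by positivity)]

lemma runningMass_jumpSum (hS : IsYuleHolding P β S) (hβ : 0 < β) (hh : Continuous h)
    (h0 : ∀ s, 0 ≤ h s) (m : ℕ) :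
    runningMass P (β * (m + 1)) (creationTime S m) (jumpSum S h m)
      = (Set.Ici 0).indicator fun t => ENNReal.ofReal (yuleWeight β m t * ageIntegral β h t) := by
  induction m with
  | zero =>
    ext t
    simp [runningMass, jumpSum, yuleWeight]
  | succ m ih =>
    ext t
    have hrec := runningMass_add_exponential (by positivity) (β * ((m + 1 : ℕ) + 1))
      (hS.measurable_creationTime m) (hS.measurable_jumpSum hh.measurable m)
      (hS.measurable m) (hS.indepFun_creationTime hh.measurable m) (hS.law m)
      hh.measurable.ennreal_ofReal t
    simp only [← creationTime_succ, ← jumpSum_succ, ih, hS.runningMass_one hβ] at hrec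
    have hcont := continuous_ageIntegral β hh
    have hnonneg (u : ℝ) (hu : 0 ≤ u) : 0 ≤ yuleWeight β m u * ageIntegral β h u ∧
        0 ≤ h u * yuleProb β m u :=
      ⟨mul_nonneg (yuleWeight_nonneg hβ m hu) (ageIntegral_nonneg hβ h0 hu),
        mul_nonneg (h0 u) (yuleProb_nonneg hβ m hu)⟩
    refine hrec.trans (Eq.trans ?_ (setLIntegral_Iic_exp_mul_indicator
      (f := fun u => β * (m + 1) * (yuleWeight β m u * ageIntegral β h u + h u * yuleProb β m u))
      (by unfold yuleProb yuleWeight; fun_prop)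
      (fun u hu => mul_nonneg (by positivity) (add_nonneg (hnonneg u hu).1 (hnonneg u hu).2))
      (by simp [ageIntegral]) (hasDerivAt_yuleWeight_succ_mul_ageIntegral β hh m)))
    congr! 3 with u
    by_cases hu : 0 ≤ u
    · simp only [Set.mem_Ici, hu, Set.indicator_of_mem]
      rw [← ENNReal.ofReal_mul (h0 u), ← ENNReal.ofReal_add (hnonneg u hu).1 (hnonneg u hu).2,
        ← ENNReal.ofReal_mul (by positivity)]
    · simp [hu]

lemma setLIntegral_popEvent (hS : IsYuleHolding P β S) (hβ : 0 < β) {m : ℕ} {Z : Ω → ℝ≥0∞}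
    (hZ : Measurable Z) (hind : IndepFun (fun ω => (creationTime S m ω, Z ω)) (S m) P) (t : ℝ) :
    ∫⁻ ω in popEvent S t m, Z ω ∂P = runningMass P (β * (m + 1)) (creationTime S m) Z t := by
  have hT := hS.measurable_creationTime m
  rw [setLIntegral_congr (hS.popEvent_ae_eq hβ t m), ← lintegral_indicator,
    lintegral_indicator_lt_add (by positivity) hT hZ (hS.measurable m) hind (hS.law m)]
  exact (measurableSet_le hT measurable_const).inter
    (measurableSet_lt measurable_const (hT.add (hS.measurable m)))

lemma setLIntegral_jumpSum (hS : IsYuleHolding P β S) (hβ : 0 < β) (hh : Continuous h)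
    (h0 : ∀ s, 0 ≤ h s) (ht : 0 ≤ t) (m : ℕ) :
    ∫⁻ ω in popEvent S t m, jumpSum S h m ω ∂P
      = ENNReal.ofReal (yuleWeight β m t * ageIntegral β h t) := by
  rw [hS.setLIntegral_popEvent hβ (hS.measurable_jumpSum hh.measurable m)
    (hS.indepFun_creationTime hh.measurable m), hS.runningMass_jumpSum hβ hh h0,
    Set.indicator_of_mem (Set.mem_Ici.2 ht)]

lemma measure_popEvent (hS : IsYuleHolding P β S) (hβ : 0 < β) (ht : 0 ≤ t) (m : ℕ) :
    P (popEvent S t m) = ENNReal.ofReal (yuleProb β m t) := by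
  have hpop := hS.setLIntegral_popEvent hβ measurable_one (hS.indepFun_creationTime_one m) t
  rw [hS.runningMass_one hβ, Set.indicator_of_mem (Set.mem_Ici.2 ht)] at hpop
  simpa only [Pi.one_apply, lintegral_const, one_mul, Measure.restrict_apply_univ] using hpop

lemma lintegral_eq_tsum (hS : IsYuleHolding P β S) (hβ : 0 < β) (ht : 0 ≤ t) (f : Ω → ℝ≥0∞) :
    ∫⁻ ω, f ω ∂P = ∑' m, ∫⁻ ω in popEvent S t m, f ω ∂P := by
  have hmeas := measurableSet_popEvent hS.measurable t
  have htotal : P (⋃ m, popEvent S t m) = 1 := by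
    rw [measure_iUnion (pairwise_disjoint_popEvent S t) hmeas]
    simp_rw [hS.measure_popEvent hβ ht]
    rw [← ENNReal.ofReal_tsum_of_nonneg (fun m => yuleProb_nonneg hβ m ht)
      (hasSum_yuleProb hβ ht).summable, (hasSum_yuleProb hβ ht).tsum_eq, ENNReal.ofReal_one]
  rw [← lintegral_iUnion hmeas (pairwise_disjoint_popEvent S t), ← setLIntegral_univ]
  refine setLIntegral_congr (ae_eq_univ.2 ?_).symm
  rwa [prob_compl_eq_zero_iff (MeasurableSet.iUnion hmeas)]

end IsYuleHolding

end YuleProcess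

/-! ### Sampling a right-continuous process at a random time -/

section Sampling

/-- The label `q` of the first point `gridPoint j q` lying strictly after `s`. -/
noncomputable def gridIndex (j : ℕ) (s : ℝ≥0) : ℕ := ⌊s * (j + 1)⌋₊

/-- The points `1 / (j + 1), 2 / (j + 1), …`, labelled from `0`, of the grid at which a process is
observed in order to approximate its value at a random time from the right. -/
noncomputable def gridPoint (j q : ℕ) : ℝ≥0 := (q + 1) / (j + 1)

lemma measurable_gridIndex (j : ℕ) : Measurable (gridIndex j) :=
  Nat.measurable_floor.comp (by fun_prop)

lemma le_gridPoint (j : ℕ) (s : ℝ≥0) : s ≤ gridPoint j (gridIndex j s) := by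
  rw [gridPoint, le_div_iff₀ (by positivity)]
  exact (Nat.lt_floor_add_one _).le

lemma gridPoint_le (j : ℕ) (s : ℝ≥0) : gridPoint j (gridIndex j s) ≤ s + 1 / (j + 1) := by
  rw [gridPoint, div_le_iff₀ (by positivity), add_mul, one_div_mul_cancel (by positivity)]
  exact add_le_add_left (Nat.floor_le (by positivity)) 1

lemma tendsto_gridPoint (s : ℝ≥0) :
    Tendsto (fun j => gridPoint j (gridIndex j s)) atTop (𝓝[≥] s) := by
  refine tendsto_nhdsWithin_iff.2
    ⟨tendsto_of_tendsto_of_tendsto_of_le_of_le tendsto_const_nhds ?_ (le_gridPoint · s)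
      (gridPoint_le · s), Eventually.of_forall fun j => le_gridPoint j s⟩
  simpa using (tendsto_one_div_add_atTop_nhds_zero_nat (𝕜 := ℝ≥0)).const_add s

lemma eventually_apply_gridPoint_eq {E : Type*} [TopologicalSpace E] [DiscreteTopology E]
    {f : ℝ≥0 → E} {s : ℝ≥0} (hf : ContinuousWithinAt f (Set.Ici s) s) :
    ∀ᶠ j in atTop, f (gridPoint j (gridIndex j s)) = f s := by
  have hlim := hf.tendsto.comp (tendsto_gridPoint s)
  rw [nhds_discrete] at hlim
  exact tendsto_pure.1 hlim

variable {Ω : Type*} [MeasurableSpace Ω]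

lemma measurable_apply_index {E : Type*} [MeasurableSpace E] {V : ℕ → Ω → E}
    (hV : ∀ q, Measurable (V q)) {i : Ω → ℕ} (hi : Measurable i) :
    Measurable fun ω => V (i ω) ω :=
  (measurable_from_prod_countable_left (f := fun z : Ω × ℕ => V z.2 z.1) hV).comp
    (measurable_id.prodMk hi)

variable {Y : ℝ≥0 → Ω → ℕ} (hY : ∀ s, Measurable (Y s))
  (hrc : ∀ ω s, ContinuousWithinAt (fun u => Y u ω) (Set.Ici s) s)

include hY hrc

lemma measurable_sample {τ : Ω → ℝ≥0} (hτ : Measurable τ) : Measurable fun ω => Y (τ ω) ω := by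
  refine measurable_of_tendsto_metrizable
    (f := fun j ω => Y (gridPoint j (gridIndex j (τ ω))) ω)
    (fun j => measurable_apply_index (fun q => hY (gridPoint j q))
      ((measurable_gridIndex j).comp hτ))
    (tendsto_pi_nhds.2 fun ω => tendsto_const_nhds.congr' ?_)
  filter_upwards [eventually_apply_gridPoint_eq (hrc ω (τ ω))] with j hj using hj.symm

variable {P : Measure Ω} [IsProbabilityMeasure P]

omit hY hrc in
lemma measure_inter_apply_index {α : Type*} [MeasurableSpace α] {U : Ω → α} (hU : Measurable U)
    {V : ℕ → Ω → ℕ} (hV : ∀ q, Measurable (V q)) (hind : IndepFun U (fun ω q => V q ω) P)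
    {i : α → ℕ} (hi : Measurable i) {B : Set α} (hB : MeasurableSet B) (n : ℕ) :
    P (U ⁻¹' B ∩ {ω | V (i (U ω)) ω = n})
      = ∫⁻ ω in U ⁻¹' B, P {ω' | V (i (U ω)) ω' = n} ∂P := by
  have hVpath : Measurable fun ω q => V q ω := measurable_pi_lambda _ hV
  set D : Set (α × (ℕ → ℕ)) := {z | z.1 ∈ B ∧ z.2 (i z.1) = n} with hDdef
  have hD : MeasurableSet D := (measurable_fst hB).inter
    (measurable_apply_index (V := fun q (z : α × (ℕ → ℕ)) => z.2 q) (fun q => by fun_prop)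
      (hi.comp measurable_fst) (measurableSet_singleton n))
  have hevent : P (U ⁻¹' B ∩ {ω | V (i (U ω)) ω = n})
      = ∫⁻ ω, D.indicator 1 (U ω, fun q => V q ω) ∂P :=
    (lintegral_indicator_one (hD.preimage (hU.prodMk hVpath))).symm
  rw [hevent, lintegral_apply_of_indepFun hU hVpath hind
    (F := fun u v => D.indicator 1 (u, v)) (measurable_one.indicator hD),
    ← lintegral_indicator (hU hB)]
  refine lintegral_congr fun ω => ?_
  by_cases hω : U ω ∈ B
  · rw [Set.indicator_of_mem (Set.mem_preimage.2 hω),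
      lintegral_map (f := fun v => D.indicator (1 : α × (ℕ → ℕ) → ℝ≥0∞) (U ω, v))
        ((measurable_one.indicator hD).comp measurable_prodMk_left) hVpath]
    refine Eq.trans ?_ (lintegral_indicator_one (hV (i (U ω)) (measurableSet_singleton n)))
    simp [hDdef, hω, Set.indicator]
  · simp [hDdef, hω, Set.indicator]

lemma tendsto_measure_apply_gridPoint (n : ℕ) (s : ℝ≥0) :
    Tendsto (fun j => P {ω | Y (gridPoint j (gridIndex j s)) ω = n}) atTop
      (𝓝 (P {ω | Y s ω = n})) := by
  refine tendsto_measure_of_tendsto_indicator_of_isFiniteMeasure atTop P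
    (fun j => hY _ (measurableSet_singleton n)) fun ω => ?_
  filter_upwards [eventually_apply_gridPoint_eq (hrc ω s)] with j hj
  simp only [hj]

lemma measure_inter_sample {α : Type*} [MeasurableSpace α] {U : Ω → α} (hU : Measurable U)
    (hind : IndepFun U (fun ω s => Y s ω) P) {τ : α → ℝ≥0} (hτ : Measurable τ)
    {B : Set α} (hB : MeasurableSet B) (n : ℕ) :
    P (U ⁻¹' B ∩ {ω | Y (τ (U ω)) ω = n}) = ∫⁻ ω in U ⁻¹' B, P {ω' | Y (τ (U ω)) ω' = n} ∂P := by
  have hgridτ (j : ℕ) : Measurable fun u => gridIndex j (τ u) := (measurable_gridIndex j).comp hτ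
  have hindgrid (j : ℕ) : IndepFun U (fun ω q => Y (gridPoint j q) ω) P :=
    hind.comp (φ := id) (ψ := fun (y : ℝ≥0 → ℕ) (q : ℕ) => y (gridPoint j q)) measurable_id
      (measurable_pi_lambda _ fun q => measurable_pi_apply _)
  have hgrid (j : ℕ) : P (U ⁻¹' B ∩ {ω | Y (gridPoint j (gridIndex j (τ (U ω)))) ω = n})
      = ∫⁻ ω in U ⁻¹' B, P {ω' | Y (gridPoint j (gridIndex j (τ (U ω)))) ω' = n} ∂P :=
    measure_inter_apply_index hU (V := fun q => Y (gridPoint j q)) (fun q => hY _)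
      (hindgrid j) (hgridτ j) hB n
  have hleft : Tendsto
      (fun j => P (U ⁻¹' B ∩ {ω | Y (gridPoint j (gridIndex j (τ (U ω)))) ω = n})) atTop
      (𝓝 (P (U ⁻¹' B ∩ {ω | Y (τ (U ω)) ω = n}))) := by
    refine tendsto_measure_of_tendsto_indicator_of_isFiniteMeasure atTop P
      (fun j => (hU hB).inter (measurable_apply_index (fun q => hY (gridPoint j q))
        ((hgridτ j).comp hU) (measurableSet_singleton n))) fun ω => ?_
    filter_upwards [eventually_apply_gridPoint_eq (hrc ω (τ (U ω)))] with j hj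
    simp only [Set.mem_inter_iff, Set.mem_ofPred_eq, hj]
  have hright : Tendsto
      (fun j => ∫⁻ ω in U ⁻¹' B, P {ω' | Y (gridPoint j (gridIndex j (τ (U ω)))) ω' = n} ∂P)
      atTop (𝓝 (∫⁻ ω in U ⁻¹' B, P {ω' | Y (τ (U ω)) ω' = n} ∂P)) := by
    refine tendsto_lintegral_of_dominated_convergence (fun _ => 1) (fun j => ?_)
      (fun j => Eventually.of_forall fun ω => prob_le_one) (by simp)
      (Eventually.of_forall fun ω => tendsto_measure_apply_gridPoint hY hrc n (τ (U ω)))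
    exact (measurable_from_top (f := fun q => P {ω' | Y (gridPoint j q) ω' = n})).comp
      ((hgridτ j).comp hU)
  simp_rw [hgrid] at hleft
  exact tendsto_nhds_unique hleft hright

end Sampling

/-! ### The randomly chosen webpage -/

section ChosenWebpage

lemma hasSum_yuleProb_div {β t : ℝ} (hβ : 0 < β) (ht : 0 < t) :
    HasSum (fun m : ℕ => yuleProb β m t / (m + 1))
      (Real.exp (-(β * t)) / (1 - Real.exp (-(β * t))) * (β * t)) := by
  have hlt : Real.exp (-(β * t)) < 1 := Real.exp_lt_one_iff.2 (neg_lt_zero.2 (by positivity))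
  have hpos : 0 < 1 - Real.exp (-(β * t)) := sub_pos.2 hlt
  have hlog := Real.hasSum_pow_div_log_of_abs_lt_one (x := 1 - Real.exp (-(β * t)))
    (by rw [abs_of_pos hpos]; exact sub_lt_self 1 (Real.exp_pos _))
  rw [sub_sub_cancel, Real.log_exp, neg_neg] at hlog
  refine (hlog.mul_left (Real.exp (-(β * t)) / (1 - Real.exp (-(β * t))))).congr_fun fun m => ?_
  rw [yuleProb, pow_succ]
  field_simp

lemma ageIntegral_one {β : ℝ} (hβ : 0 < β) (t : ℝ) :
    ageIntegral β (fun _ => 1) t = Real.exp (β * t) - 1 := by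
  simp [ageIntegral, hβ.ne']

lemma ageIntegral_comp_sub (β t : ℝ) (p : ℝ → ℝ) :
    ageIntegral β (fun s => p (t - s)) t
      = Real.exp (β * t) * ∫ y in (0 : ℝ)..t, β * Real.exp (-β * y) * p y := by
  have hreflect := intervalIntegral.integral_comp_sub_left
    (fun y => Real.exp (β * t) * (β * Real.exp (-β * y) * p y)) t (a := 0) (b := t)
  rw [sub_self, sub_zero] at hreflect
  rw [ageIntegral, ← intervalIntegral.integral_const_mul, ← hreflect]
  congr 1 with s
  rw [show β * s = β * t + -β * (t - s) by ring, Real.exp_add]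
  ring

/-- The factor, common to all observables of the age of the chosen webpage, by which the integral
against the birth intensity is multiplied. Its value is never needed: it cancels in conditional
probabilities. -/
noncomputable def choiceFactor (β t : ℝ) : ℝ≥0∞ :=
  ∑' m : ℕ, ((m + 1 : ℕ) : ℝ≥0∞)⁻¹ * ENNReal.ofReal (yuleWeight β m t)

lemma choiceFactor_ne_zero (β t : ℝ) : choiceFactor β t ≠ 0 := by
  intro hzero
  have hone := ENNReal.tsum_eq_zero.1 hzero 1
  have hweight : 0 < yuleWeight β 1 t := by simp [yuleWeight, Real.exp_pos]
  simp [hweight.not_ge] at hone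

variable {Ω : Type*} [MeasurableSpace Ω] {P : Measure Ω}

lemma measure_ne_zero_inter_eq_tsum {J : Ω → ℕ} (hJ : Measurable J) {A : ℕ → Set Ω}
    (hA : ∀ k, MeasurableSet (A k)) :
    P ({ω | J ω ≠ 0} ∩ {ω | ω ∈ A (J ω)}) = ∑' k : ℕ, P ({ω | J ω = k + 1} ∩ A (k + 1)) := by
  have hunion : {ω | J ω ≠ 0} ∩ {ω | ω ∈ A (J ω)} = ⋃ k : ℕ, ({ω | J ω = k + 1} ∩ A (k + 1)) := by
    ext ω
    rcases hJω : J ω with _ | k <;> simp [hJω]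
  rw [hunion]
  exact measure_iUnion
    (fun k k' hne => Set.disjoint_left.2 fun ω hk hk' =>
      hne (Nat.succ_injective (hk.1.symm.trans hk'.1)))
    fun k => (hJ (measurableSet_singleton (k + 1))).inter (hA (k + 1))

variable {β ν t : ℝ} {rate : ℕ → ℝ} {S : ℕ → Ω → ℝ} {X : ℕ → ℝ≥0 → Ω → ℕ} {J : Ω → ℕ}

lemma setLIntegral_popEvent_inv_numPages (hS : ∀ k, Measurable (S k)) {A : Set Ω}
    (hA : MeasurableSet A) (k m : ℕ) :
    ∫⁻ ω in popEvent S t m,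
        ({ω | creationTime S k ω ≤ t} ∩ A).indicator (fun ω => (numPages S t ω : ℝ≥0∞)⁻¹) ω ∂P
      = if k ≤ m then ((m + 1 : ℕ) : ℝ≥0∞)⁻¹ * P (popEvent S t m ∩ A) else 0 := by
  have hpop : ∀ ω ∈ popEvent S t m,
      ({ω | creationTime S k ω ≤ t} ∩ A).indicator (fun ω => (numPages S t ω : ℝ≥0∞)⁻¹) ω
        = if k ≤ m then A.indicator (fun _ => ((m + 1 : ℕ) : ℝ≥0∞)⁻¹) ω else 0 := by
    intro ω hω
    have hpresent : creationTime S k ω ≤ t ↔ k ≤ m := hω k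
    by_cases hk : k ≤ m <;> by_cases hωA : ω ∈ A <;>
      simp [hpresent, hk, hωA, numPages_of_mem_popEvent hω]
  rw [setLIntegral_congr_fun (measurableSet_popEvent hS t m) hpop]
  split_ifs
  · rw [lintegral_indicator_const hA, Measure.restrict_apply hA, Set.inter_comm]
  · simp

/-- The event that webpage `k` has `n` in-links at time `t`. -/
def sizeEvent (S : ℕ → Ω → ℝ) (X : ℕ → ℝ≥0 → Ω → ℕ) (t : ℝ) (n k : ℕ) : Set Ω :=
  {ω | X k (t - creationTime S k ω).toNNReal ω = n}

namespace IsGeneralizedYuleModel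

lemma isYuleHolding (hM : IsGeneralizedYuleModel P β ν rate S X) : IsYuleHolding P β S :=
  ⟨hM.measurable_holding, hM.law_holding, hM.indep_holding⟩

lemma networkInfo_le (hM : IsGeneralizedYuleModel P β ν rate S X) :
    networkInfo S X ≤ (inferInstance : MeasurableSpace Ω) :=
  Measurable.comap_le <| (measurable_pi_lambda _ hM.measurable_holding).prodMk <|
    measurable_pi_lambda _ fun k => measurable_pi_lambda _ (hM.birth k).measurable

lemma measurableSet_sizeEvent (hM : IsGeneralizedYuleModel P β ν rate S X) (t : ℝ) (n k : ℕ) :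
    MeasurableSet[networkInfo S X] (sizeEvent S X t n k) := by
  have hrc := (hM.birth k).right_continuous
  let _ : MeasurableSpace Ω := networkInfo S X
  have hnetwork : Measurable fun ω => ((fun k => S k ω), (fun k s => X k s ω)) :=
    comap_measurable _
  have hS (i : ℕ) : Measurable (S i) := (measurable_pi_apply i).comp hnetwork.fst
  have hX (s : ℝ≥0) : Measurable (X k s) :=
    (measurable_pi_apply s).comp ((measurable_pi_apply k).comp hnetwork.snd)
  exact measurable_sample hX hrc
    ((measurable_creationTime fun i _ => hS i).const_sub t).real_toNNReal
    (measurableSet_singleton n)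

lemma stateProb_eq (hM : IsGeneralizedYuleModel P β ν rate S X) (k : ℕ) :
    stateProb P (X k) = stateProb P (X 0) := by
  ext n s
  have heval : Measurable fun x : ℝ≥0 → ℕ => x s.toNNReal := measurable_pi_apply _
  have hn : MeasurableSet {x : ℝ≥0 → ℕ | x s.toNNReal = n} := heval (measurableSet_singleton n)
  exact congrArg ENNReal.toReal ((hM.identDistrib k).measure_mem_eq hn)

variable [IsProbabilityMeasure P]

lemma measure_popEvent_inter_sizeEvent (hM : IsGeneralizedYuleModel P β ν rate S X) (t : ℝ)
    (m n k : ℕ) :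
    P (popEvent S t m ∩ sizeEvent S X t n k)
      = ∫⁻ ω in popEvent S t m,
          ENNReal.ofReal (stateProb P (X 0) n (t - creationTime S k ω)) ∂P := by
  have hcoord (i : ℕ) : Measurable fun u : ℕ → ℝ => u i := measurable_pi_apply i
  have hind : IndepFun (fun ω k => S k ω) (fun ω s => X k s ω) P :=
    hM.indep_holding_inlinks.comp (φ := id) (ψ := fun x : ℕ → ℝ≥0 → ℕ => x k) measurable_id
      (measurable_pi_apply k)
  have hsample := measure_inter_sample (hM.birth k).measurable (hM.birth k).right_continuous
    (measurable_pi_lambda _ hM.measurable_holding) hind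
    (τ := fun u => (t - creationTime (fun i u => u i) k u).toNNReal)
    ((measurable_creationTime fun i _ => hcoord i).const_sub t).real_toNNReal
    (B := popEvent (fun i u => u i) t m) (measurableSet_popEvent hcoord t m) n
  refine hsample.trans (lintegral_congr fun ω => ?_)
  rw [← hM.stateProb_eq k, stateProb, ofReal_measureReal]
  rfl

lemma measure_choice_inter (hM : IsGeneralizedYuleModel P β ν rate S X) (hβ : 0 < β)
    (ht : 0 ≤ t) (hJ : IsUniformChoice P S X t J) (k : ℕ) {A : Set Ω}
    (hA : MeasurableSet[networkInfo S X] A) :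
    P ({ω | J ω = k} ∩ A)
      = ∑' m : ℕ, if k ≤ m then ((m + 1 : ℕ) : ℝ≥0∞)⁻¹ * P (popEvent S t m ∩ A) else 0 := by
  have hA' : MeasurableSet A := hM.networkInfo_le _ hA
  have hpresent : MeasurableSet {ω | creationTime S k ω ≤ t} :=
    measurableSet_le (hM.isYuleHolding.measurable_creationTime k) measurable_const
  rw [hJ.uniform k A hA, ← lintegral_indicator (hpresent.inter hA'),
    hM.isYuleHolding.lintegral_eq_tsum hβ ht]
  exact tsum_congr (setLIntegral_popEvent_inv_numPages hM.measurable_holding hA' k)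

lemma measure_ne_zero_inter (hM : IsGeneralizedYuleModel P β ν rate S X) (hβ : 0 < β)
    (ht : 0 ≤ t) (hJ : IsUniformChoice P S X t J) {A : ℕ → Set Ω}
    (hA : ∀ k, MeasurableSet[networkInfo S X] (A k)) {h : ℝ → ℝ} (hh : Continuous h)
    (h0 : ∀ s, 0 ≤ h s) (hAh : ∀ m k, P (popEvent S t m ∩ A k)
      = ∫⁻ ω in popEvent S t m, ENNReal.ofReal (h (creationTime S k ω)) ∂P) :
    P ({ω | J ω ≠ 0} ∩ {ω | ω ∈ A (J ω)})
      = choiceFactor β t * ENNReal.ofReal (ageIntegral β h t) := by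
  have hsize (m : ℕ) : ∑ k ∈ Finset.range m, P (popEvent S t m ∩ A (k + 1))
      = ENNReal.ofReal (yuleWeight β m t) * ENNReal.ofReal (ageIntegral β h t) := by
    have hmeas (k : ℕ) : Measurable fun ω => ENNReal.ofReal (h (creationTime S (k + 1) ω)) :=
      (hh.measurable.comp (hM.isYuleHolding.measurable_creationTime (k + 1))).ennreal_ofReal
    simp_rw [hAh]
    rw [← lintegral_finsetSum _ fun k _ => hmeas k,
      ← ENNReal.ofReal_mul (yuleWeight_nonneg hβ m ht)]
    exact hM.isYuleHolding.setLIntegral_jumpSum hβ hh h0 ht m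
  rw [measure_ne_zero_inter_eq_tsum hJ.measurable fun k => hM.networkInfo_le _ (hA k)]
  simp_rw [hM.measure_choice_inter hβ ht hJ _ (hA _)]
  rw [ENNReal.tsum_comm, choiceFactor, ← ENNReal.tsum_mul_right]
  refine tsum_congr fun m => ?_
  have hsupport : ∀ k ∉ Finset.range m,
      (if k + 1 ≤ m then ((m + 1 : ℕ) : ℝ≥0∞)⁻¹ * P (popEvent S t m ∩ A (k + 1)) else 0) = 0 :=
    fun k hk => if_neg (Finset.mem_range.not.1 hk)
  rw [tsum_eq_sum hsupport, mul_assoc, ← hsize m, Finset.mul_sum]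
  exact Finset.sum_congr rfl fun k hk => if_pos (Finset.mem_range.1 hk)

section Choice

variable (hM : IsGeneralizedYuleModel P β ν rate S X) (hβ : 0 < β) (ht : 0 < t)
  (hJ : IsUniformChoice P S X t J)

include hM hβ ht hJ

lemma measure_ne_zero :
    P {ω | J ω ≠ 0} = choiceFactor β t * ENNReal.ofReal (Real.exp (β * t) - 1) := by
  have hall := hM.measure_ne_zero_inter hβ ht.le hJ (A := fun _ => Set.univ)
    (fun _ => MeasurableSet.univ) (h := fun _ => 1) continuous_const (fun _ => zero_le_one)
    (fun _ _ => by simp)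
  rw [ageIntegral_one hβ] at hall
  simpa using hall

lemma choiceFactor_ne_top : choiceFactor β t ≠ ⊤ := by
  intro htop
  have hle : P {ω | J ω ≠ 0} ≤ 1 := prob_le_one
  have hpos : 0 < Real.exp (β * t) - 1 := sub_pos.2 (Real.one_lt_exp_iff.2 (by positivity))
  rw [hM.measure_ne_zero hβ ht hJ, htop, ENNReal.top_mul (by simpa using hpos)] at hle
  exact absurd hle (by simp)

lemma measure_ne_zero_inter_chosenSize (n : ℕ) :
    P ({ω | J ω ≠ 0} ∩ {ω | chosenSize S X t J ω = n})
      = choiceFactor β t * ENNReal.ofReal (Real.exp (β * t) *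
          ∫ y in (0 : ℝ)..t, β * Real.exp (-β * y) * stateProb P (X 0) n y) := by
  have hcont := (hM.birth 0).continuous_stateProb n
  rw [← ageIntegral_comp_sub]
  exact hM.measure_ne_zero_inter hβ ht.le hJ (A := sizeEvent S X t n)
    (hM.measurableSet_sizeEvent t n) (h := fun s => stateProb P (X 0) n (t - s)) (by fun_prop)
    (fun _ => measureReal_nonneg) (fun m k => hM.measure_popEvent_inter_sizeEvent t m n k)

lemma condSizeProb_eq (n : ℕ) :
    condSizeProb P S X t J n = 1 / (1 - Real.exp (-β * t)) *
      ∫ y in (0 : ℝ)..t, β * Real.exp (-β * y) * stateProb P (X 0) n y := by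
  have hI : 0 ≤ ∫ y in (0 : ℝ)..t, β * Real.exp (-β * y) * stateProb P (X 0) n y :=
    intervalIntegral.integral_nonneg ht.le fun y _ => mul_nonneg (by positivity) measureReal_nonneg
  have hpos : 0 < Real.exp (β * t) - 1 := sub_pos.2 (Real.one_lt_exp_iff.2 (by positivity))
  have hfactor : (choiceFactor β t).toReal ≠ 0 :=
    (ENNReal.toReal_pos (choiceFactor_ne_zero β t) (hM.choiceFactor_ne_top hβ ht hJ)).ne'
  have hnormal : 1 / (1 - Real.exp (-β * t)) = Real.exp (β * t) / (Real.exp (β * t) - 1) := by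
    rw [neg_mul, Real.exp_neg, ← mul_div_mul_left 1 _ (Real.exp_pos (β * t)).ne', mul_sub,
      mul_inv_cancel₀ (Real.exp_pos _).ne', mul_one]
  have hlater : MeasurableSet {ω | J ω ≠ 0} := (hJ.measurable (measurableSet_singleton 0)).compl
  rw [condSizeProb, measureReal_def, cond_apply hlater,
    hM.measure_ne_zero hβ ht hJ, hM.measure_ne_zero_inter_chosenSize hβ ht hJ n, hnormal]
  simp only [ENNReal.toReal_mul, ENNReal.toReal_inv, ENNReal.toReal_ofReal hpos.le,
    ENNReal.toReal_ofReal (mul_nonneg (Real.exp_pos (β * t)).le hI)]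
  field_simp

lemma measureReal_eq_zero :
    P.real {ω | J ω = 0} = Real.exp (-(β * t)) / (1 - Real.exp (-(β * t))) * (β * t) := by
  have hall := hM.measure_choice_inter hβ ht.le hJ 0 (A := Set.univ) MeasurableSet.univ
  have hterm (m : ℕ) : ((m + 1 : ℕ) : ℝ≥0∞)⁻¹ * ENNReal.ofReal (yuleProb β m t)
      = ENNReal.ofReal (yuleProb β m t / (m + 1)) := by
    rw [← ENNReal.ofReal_natCast, ← ENNReal.ofReal_inv_of_pos (by positivity),
      ← ENNReal.ofReal_mul (by positivity), mul_comm, div_eq_mul_inv, Nat.cast_succ]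
  simp only [Set.inter_univ, zero_le, if_true, hM.isYuleHolding.measure_popEvent hβ ht.le,
    hterm] at hall
  have hnonneg (m : ℕ) : 0 ≤ yuleProb β m t / (m + 1) :=
    div_nonneg (yuleProb_nonneg hβ m ht.le) (by positivity)
  have hsum := hasSum_yuleProb_div hβ ht
  rw [measureReal_def, hall, ← ENNReal.ofReal_tsum_of_nonneg hnonneg hsum.summable,
    ENNReal.toReal_ofReal (tsum_nonneg hnonneg), hsum.tsum_eq]

end Choice

end IsGeneralizedYuleModel

end ChosenWebpage

/-! ### The number of in-links of the chosen webpage -/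

section ChosenSize

lemma sum_Icc_choose_eq_sum_range (n : ℕ) (f : ℕ → ℝ) :
    ∑ j ∈ Finset.Icc 1 n, ((n - 1).choose (j - 1) : ℝ) * (-1) ^ (j - 1) * f j
      = ∑ j ∈ Finset.range n, ((n - 1).choose j : ℝ) * (-1) ^ j * f (j + 1) := by
  rw [← Finset.Ico_add_one_right_eq_Icc, Finset.sum_Ico_eq_sum_range, Nat.add_sub_cancel]
  simp only [add_comm 1, Nat.add_sub_cancel]

lemma tendsto_exp_neg_mul_atTop {β : ℝ} (hβ : 0 < β) :
    Tendsto (fun t => Real.exp (-β * t)) atTop (𝓝 0) :=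
  Real.tendsto_exp_atBot.comp (tendsto_id.const_mul_atTop_of_neg (neg_neg_of_pos hβ))

lemma yuleSimon_div_eq {β : ℝ} (hβ : 0 < β) (ν lam : ℝ) (n : ℕ) :
    yuleSimon (β ^ ν / lam) n / β = β ^ (ν - 1) / lam *
      (Real.Gamma (β ^ ν / lam + 1) * Real.Gamma n / Real.Gamma (β ^ ν / lam + n + 1)) := by
  rw [yuleSimon, Real.rpow_sub_one hβ.ne']
  ring

lemma sum_choose_tsum_lowerTerm_eq_sub {β ν lam t : ℝ} (hβ : 0 < β) (hν : 0 < ν)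
    (hlam : 0 < lam) (ht : 0 < t) {n : ℕ} (hn : 1 ≤ n) (hn' : lam * n < β ^ ν) :
    ∑ j ∈ Finset.range n, ((n - 1).choose j : ℝ) * (-1) ^ j * ∑' r, lowerTerm β ν lam t (j + 1) r
      = yuleSimon (β ^ ν / lam) n - ∑ j ∈ Finset.range n,
          ((n - 1).choose j : ℝ) * (-1) ^ j * ∑' r, upperTerm β ν lam t (j + 1) r := by
  obtain ⟨m, rfl⟩ := Nat.exists_eq_add_of_le' hn
  rw [← sum_choose_div_eq_yuleSimon (div_pos (Real.rpow_pos_of_pos hβ ν) hlam),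
    Nat.add_sub_cancel, ← Finset.sum_sub_distrib]
  refine Finset.sum_congr rfl fun j hj => ?_
  have hjm : j + 1 ≤ m + 1 := Finset.mem_range.1 hj
  have hj' : lam * ((j + 1 : ℕ) : ℝ) < β ^ ν := lt_of_le_of_lt (by gcongr) hn'
  rw [tsum_upperTerm hβ hν hlam ht hj', Nat.cast_succ]
  ring

namespace IsGeneralizedYuleModel

variable {Ω : Type*} [MeasurableSpace Ω] {P : Measure Ω} [IsProbabilityMeasure P]
  {β ν lam t : ℝ} {rate : ℕ → ℝ} {S : ℕ → Ω → ℝ} {X : ℕ → ℝ≥0 → Ω → ℕ} {n : ℕ}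

section FiniteTime

variable {J : Ω → ℕ} (hM : IsGeneralizedYuleModel P β ν (fun r => lam * r) S X) (hβ : 0 < β)
  (hν0 : 0 < ν) (hν1 : ν < 1) (ht : 0 < t) (hJ : IsUniformChoice P S X t J)

include hM hβ hν0 hν1 ht hJ

lemma condSizeProb_eq_sub_integral_Ioi (hlam : 0 < lam) (hn : 1 ≤ n) (k : ℕ) :
    condSizeProb P S X t J n = β / (1 - Real.exp (-β * t)) *
      (β ^ (ν - 1) / lam *
          (Real.Gamma (β ^ ν / lam + 1) * Real.Gamma n / Real.Gamma (β ^ ν / lam + n + 1))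
        - ∫ y in Set.Ioi t, Real.exp (-β * y) * stateProb P (X k) n y) := by
  have hint := (hM.birth 0).integrableOn_exp_mul_stateProb hβ n
  rw [hM.stateProb_eq k, ← yuleSimon_div_eq hβ,
    ← (hM.birth 0).laplace_stateProb_eq_yuleSimon hβ hν0 hν1 hlam hn,
    ← intervalIntegral.integral_interval_add_Ioi (hint 0) (hint t), add_sub_cancel_right,
    hM.condSizeProb_eq hβ ht hJ]
  simp_rw [mul_assoc β]
  rw [intervalIntegral.integral_const_mul]
  ring

lemma condSizeProb_eq_sum_lowerTerm (n : ℕ) :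
    condSizeProb P S X t J n = 1 / (1 - Real.exp (-β * t)) *
      ∑ j ∈ Finset.Icc 1 n, ((n - 1).choose (j - 1) : ℝ) * (-1) ^ (j - 1) *
        ∑' r, lowerTerm β ν lam t j r := by
  rw [hM.condSizeProb_eq hβ ht hJ, (hM.birth 0).integral_exp_mul_stateProb hβ hν0 hν1 n ht,
    sum_Icc_choose_eq_sum_range n fun j => ∑' r, lowerTerm β ν lam t j r]

lemma condSizeProb_eq_sub_sum_upperTerm (hlam : 0 < lam) (hn : 1 ≤ n) (hn' : lam * n < β ^ ν) :
    condSizeProb P S X t J n = 1 / (1 - Real.exp (-β * t)) *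
      (yuleSimon (β ^ ν / lam) n
        - ∑ j ∈ Finset.Icc 1 n, ((n - 1).choose (j - 1) : ℝ) * (-1) ^ (j - 1) *
            ∑' r, upperTerm β ν lam t j r) := by
  rw [hM.condSizeProb_eq hβ ht hJ, (hM.birth 0).integral_exp_mul_stateProb hβ hν0 hν1 n ht,
    sum_choose_tsum_lowerTerm_eq_sub hβ hν0 hlam ht hn hn',
    sum_Icc_choose_eq_sum_range n fun j => ∑' r, upperTerm β ν lam t j r]

end FiniteTime

section Limit

variable {J : ℝ → Ω → ℕ}

lemma tendsto_condSizeProb (hM : IsGeneralizedYuleModel P β ν (fun r => lam * r) S X)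
    (hβ : 0 < β) (hν0 : 0 < ν) (hν1 : ν < 1) (hlam : 0 < lam)
    (hJ : ∀ t : ℝ, 0 < t → IsUniformChoice P S X t (J t)) (hn : 1 ≤ n) :
    Tendsto (fun t => condSizeProb P S X t (J t) n) atTop (𝓝 (yuleSimon (β ^ ν / lam) n)) := by
  have hnormal : Tendsto (fun t => 1 / (1 - Real.exp (-β * t))) atTop (𝓝 1) := by
    simpa using ((tendsto_exp_neg_mul_atTop hβ).const_sub 1).inv₀ (by simp)
  have hlaplace : Tendsto
      (fun t => ∫ y in (0 : ℝ)..t, β * Real.exp (-β * y) * stateProb P (X 0) n y) atTop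
      (𝓝 (yuleSimon (β ^ ν / lam) n)) := by
    have hlim := (intervalIntegral_tendsto_integral_Ioi 0
      ((hM.birth 0).integrableOn_exp_mul_stateProb hβ n 0) tendsto_id).const_mul β
    rw [(hM.birth 0).laplace_stateProb_eq_yuleSimon hβ hν0 hν1 hlam hn,
      mul_div_cancel₀ _ hβ.ne'] at hlim
    simpa only [← intervalIntegral.integral_const_mul, ← mul_assoc, id_eq] using hlim
  have hlim := hnormal.mul hlaplace
  rw [one_mul] at hlim
  refine hlim.congr' ?_
  filter_upwards [eventually_gt_atTop 0] with t ht using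
    (hM.condSizeProb_eq hβ ht (hJ t ht) n).symm

lemma tendsto_measureReal_eq_zero (hM : IsGeneralizedYuleModel P β ν rate S X) (hβ : 0 < β)
    (hJ : ∀ t : ℝ, 0 < t → IsUniformChoice P S X t (J t)) :
    Tendsto (fun t => P.real {ω | J t ω = 0}) atTop (𝓝 0) := by
  have hnum : Tendsto (fun t => (β * t) ^ 1 * Real.exp (-(β * t))) atTop (𝓝 0) :=
    (Real.tendsto_pow_mul_exp_neg_atTop_nhds_zero 1).comp (tendsto_id.const_mul_atTop hβ)
  have hlim := hnum.div ((tendsto_exp_neg_mul_atTop hβ).const_sub 1) (by simp)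
  rw [zero_div] at hlim
  refine hlim.congr' ?_
  filter_upwards [eventually_gt_atTop 0] with t ht
  rw [hM.measureReal_eq_zero hβ ht (hJ t ht)]
  simp only [Pi.div_apply, pow_one, neg_mul]
  ring

omit [IsProbabilityMeasure P] in
lemma condSizeProb_eq_measureReal_sdiff {J : Ω → ℕ} (hJ : Measurable J) (n : ℕ) :
    condSizeProb P S X t J n = (P.real {ω | J ω = 0}ᶜ)⁻¹ *
      P.real ({ω | chosenSize S X t J ω = n} \ {ω | J ω = 0}) := by
  have hlater : MeasurableSet {ω | J ω = 0}ᶜ := (hJ (measurableSet_singleton 0)).compl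
  rw [condSizeProb, measureReal_def, show {ω | J ω ≠ 0} = {ω | J ω = 0}ᶜ from rfl,
    cond_apply hlater, ENNReal.toReal_mul, ENNReal.toReal_inv, Set.inter_comm, ← Set.sdiff_eq]
  rfl

lemma tendsto_chosenSize (hM : IsGeneralizedYuleModel P β ν rate S X) (hβ : 0 < β)
    (hJ : ∀ t : ℝ, 0 < t → IsUniformChoice P S X t (J t)) {q : ℝ}
    (hq : Tendsto (fun t => condSizeProb P S X t (J t) n) atTop (𝓝 q)) :
    Tendsto (fun t => P.real {ω | chosenSize S X t (J t) ω = n}) atTop (𝓝 q) := by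
  have hinitial := hM.tendsto_measureReal_eq_zero hβ hJ
  have hinter : Tendsto
      (fun t => P.real ({ω | chosenSize S X t (J t) ω = n} ∩ {ω | J t ω = 0})) atTop (𝓝 0) :=
    squeeze_zero (fun _ => measureReal_nonneg)
      (fun t => measureReal_mono Set.inter_subset_right) hinitial
  have hlim := hinter.add ((hinitial.const_sub 1).mul hq)
  rw [sub_zero, one_mul, zero_add] at hlim
  refine hlim.congr' ?_
  filter_upwards [eventually_gt_atTop 0, hinitial.eventually_lt_const one_pos] with t ht hlt
  have hmeas : MeasurableSet {ω | J t ω = 0} := (hJ t ht).measurable (measurableSet_singleton 0)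
  rw [condSizeProb_eq_measureReal_sdiff (hJ t ht).measurable, probReal_compl_eq_one_sub hmeas,
    mul_inv_cancel_left₀ (sub_ne_zero.2 hlt.ne'), measureReal_inter_add_sdiff hmeas]

end Limit

end IsGeneralizedYuleModel

end ChosenSize

end FractionalYule

open FractionalYule

theorem mainTheorem4 {Ω : Type*} [MeasurableSpace Ω] (P : Measure Ω) [IsProbabilityMeasure P]
    (β ν lam : ℝ) (hβ : 0 < β) (hν0 : 0 < ν) (hν1 : ν < 1) (hlam : 0 < lam)
    (S : ℕ → Ω → ℝ) (X : ℕ → ℝ≥0 → Ω → ℕ) (J : ℝ → Ω → ℕ)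
    (hmodel : FractionalYule.IsGeneralizedYuleModel P β ν (fun r => lam * r) S X)
    (hJ : ∀ t : ℝ, 0 < t → FractionalYule.IsUniformChoice P S X t (J t)) :
    -- the finite-time distribution
    (∀ t : ℝ, 0 < t → ∀ n : ℕ, 1 ≤ n →
      (∀ k : ℕ,
        IntegrableOn (fun y => Real.exp (-β * y) * FractionalYule.stateProb P (X k) n y)
          (Set.Ioi t) ∧
        FractionalYule.condSizeProb P S X t (J t) n
          = β / (1 - Real.exp (-β * t)) *
            (β ^ (ν - 1) / lam *
                (Real.Gamma (β ^ ν / lam + 1) * Real.Gamma n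
                  / Real.Gamma (β ^ ν / lam + n + 1))
              - ∫ y in Set.Ioi t,
                  Real.exp (-β * y) * FractionalYule.stateProb P (X k) n y)) ∧
      (∀ j : ℕ, 1 ≤ j → Summable (FractionalYule.lowerTerm β ν lam t j)) ∧
      FractionalYule.condSizeProb P S X t (J t) n
        = 1 / (1 - Real.exp (-β * t)) *
          ∑ j ∈ Finset.Icc 1 n, ((n - 1).choose (j - 1) : ℝ) * (-1) ^ (j - 1) *
            ∑' r : ℕ, FractionalYule.lowerTerm β ν lam t j r ∧
      (∀ j : ℕ, 1 ≤ j →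
        (Summable (FractionalYule.upperTerm β ν lam t j) ↔ lam * j < β ^ ν)) ∧
      (lam * n < β ^ ν →
        FractionalYule.condSizeProb P S X t (J t) n
          = 1 / (1 - Real.exp (-β * t)) *
            (β ^ ν / lam *
                (Real.Gamma (β ^ ν / lam + 1) * Real.Gamma n
                  / Real.Gamma (β ^ ν / lam + n + 1))
              - ∑ j ∈ Finset.Icc 1 n, ((n - 1).choose (j - 1) : ℝ) * (-1) ^ (j - 1) *
                  ∑' r : ℕ, FractionalYule.upperTerm β ν lam t j r))) ∧
    -- the limiting distribution
    (∀ n : ℕ, 1 ≤ n →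
      Tendsto (fun t : ℝ => FractionalYule.condSizeProb P S X t (J t) n) atTop
        (𝓝 (FractionalYule.yuleSimon (β ^ ν / lam) n)) ∧
      Tendsto (fun t : ℝ => P.real {ω | FractionalYule.chosenSize S X t (J t) ω = n}) atTop
        (𝓝 (FractionalYule.yuleSimon (β ^ ν / lam) n))) ∧
    -- the limit is a probability distribution on the positive integers
    HasSum (fun m : ℕ => FractionalYule.yuleSimon (β ^ ν / lam) (m + 1)) 1 := by
  have hlim (n : ℕ) (hn : 1 ≤ n) := hmodel.tendsto_condSizeProb hβ hν0 hν1 hlam hJ hn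
  refine ⟨fun t ht n hn => ?_, fun n hn => ⟨hlim n hn, ?_⟩, ?_⟩
  · refine ⟨fun k => ⟨?_, ?_⟩, fun j _ => ?_, ?_, fun j _ => ?_, fun hn' => ?_⟩
    · exact (hmodel.birth k).integrableOn_exp_mul_stateProb hβ n t
    · exact hmodel.condSizeProb_eq_sub_integral_Ioi hβ hν0 hν1 ht (hJ t ht) hlam hn k
    · exact (hasSum_lowerTerm hβ hν0 ht j).summable
    · exact hmodel.condSizeProb_eq_sum_lowerTerm hβ hν0 hν1 ht (hJ t ht) n
    · exact summable_upperTerm_iff hβ hν0 hlam ht j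
    · exact hmodel.condSizeProb_eq_sub_sum_upperTerm hβ hν0 hν1 ht (hJ t ht) hlam hn hn'
  · exact hmodel.tendsto_chosenSize hβ hJ (hlim n hn)
  · exact hasSum_yuleSimon (div_pos (Real.rpow_pos_of_pos hβ ν) hlam)
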